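/- Let $U=\mathbb P^1(\mathbb C)\setminus\{0,1,\infty\}$. A base point of $U$ is either a point of $U$ or a tangential base point, i.e. a nonzero tangent vector $v$ at one of $0,1,\infty$ (written in the local parameters $t$, $t-1$, $1/t$); $\overrightarrow{01}$ is the tangent vector $1$ at $0$ and $\overrightarrow{10}$ is the tangent vector $-1$ at $1$. A homotopy class of paths ending (or starting) at a tangential base point is a homotopy class of paths ending (starting) on an arc which leaves the puncture with the given tangent vector, compatible with moving the end point along this arc. Paths are composed from left to right. Let $\delta$ be the class from $\overrightarrow{01}$ to $\overrightarrow{10}$ of the straight path along $(0,1)$. Iterated integrals along such classes are computed on piecewise smooth representatives; at tangential ends they are regularised in the usual way: cut the path off at the parameter $\varepsilon$ on the arcs ($t=\varepsilon v$, $t=1+\varepsilon v$, resp. $t\sim 1/(\varepsilon v)$), write the result as a polynomial in $\log\varepsilon$ plus $o(1)$ as $\varepsilon\to0^+$, and take the constant term of the polynomial (this is the limit whenever the integral converges). For a class $\gamma$ from $\overrightarrow{01}$ to a base point $z$ put $$\log(z;\gamma)=\int_{\delta^{-1}\cdot\gamma}\frac{dt}{t},$$ and for a nonempty multi-index $\mathbf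 k=(k_1,\dots,k_d)$ of positive integers let $Li_{\mathbf k}(z;\gamma)$ be the iterated integral along $\gamma$ determined by $Li_{1}(z;\gamma)=\int_\gamma\frac{dt}{1-t}$ and $$Li_{k_1,\dots,k_d}(z;\gamma)=\int_\gamma \frac{dt}{t}\,Li_{k_1,\dots,k_{d-1},k_d-1}(t;\gamma_t)\ \ (k_d\ne1),\qquad Li_{k_1,\dots,k_{d-1},1}(z;\gamma)=\int_\gamma\frac{dt}{1-t}\,Li_{k_1,\dots,k_{d-1}}(t;\gamma_t)\ \ (d\ge 2),$$ where $\gamma_t$ is the part of $\gamma$ up to $t$. Let $\zeta(\mathbf k)=Li_{\mathbf k}(\overrightarrow{10};\delta)$. **Theorem (duality-reflection formula).** Let $z$ be a (possibly tangential) base point of $U$, let $\gamma$ be a homotopy class of paths in $U$ from $\overrightarrow{01}$ to $z$, and let $\gamma'=\delta\cdot\phi(\gamma)$, a class from $\overrightarrow{01}$ to $1-z:=\phi(z)$, where $\phi(t)=1-t$. Then $\log(z;\gamma)$ and all $Li_{\mathbf k}(z;\gamma)$ are well defined (the regularised integrals exist and depend only on the homotopy class), and for all integers $n,m\ge2$ $$\sum_{j=0}^{m-1}\frac{(-\log(z;\gamma))^j}{j!}\,Li_{\underbrace{\scriptstyle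 1,\dots,1}_{n-2},\,m-j}(z;\gamma)+\sum_{j=0}^{n-2}\frac{(-\log(1-z;\gamma'))^j}{j!}\,Li_{\underbrace{\scriptstyle 1,\dots,1}_{m-2},\,n-j}(1-z;\gamma')=\zeta(\underbrace{1,\dots,1}_{n-2},m).$$ -/

import Mathlib

open Set Filter Topology
open scoped ContDiff

noncomputable section

namespace MPL

/-! ### The space and its base points -/

/-- The space `ℙ¹(ℂ) ∖ {0, 1, ∞} = ℂ ∖ {0, 1}`. -/
abbrev U : Type := {t : ℂ // t ≠ 0 ∧ t ≠ 1}

/-- The automorphism `φ(t) = 1 - t`. -/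
def phi : C(U, U) where
  toFun t := ⟨1 - t.1, sub_ne_zero.mpr (Ne.symm t.2.2), fun h => t.2.1 (by linear_combination -h)⟩
  continuous_toFun := by fun_prop

/-- A (possibly tangential) base point of `ℙ¹(ℂ) ∖ {0, 1, ∞}`: a point, or a nonzero tangent vector
at one of the points `0`, `1`, `∞`, given by its coordinate with respect to the local parameter
`t`, `t - 1`, `1 / t` respectively. -/
inductive BasePoint where
  | point (z : U)
  | atZero (v : ℂˣ)
  | atOne (v : ℂˣ)
  | atInfty (v : ℂˣ)

namespace BasePoint

/-- The arc representing a tangential base point is used for parameters `0 < ε < radius`. -/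
def radius : BasePoint → ℝ
  | point _ => 1
  | atZero v => ‖(v : ℂ)‖⁻¹
  | atOne v => ‖(v : ℂ)‖⁻¹
  | atInfty v => ‖(v : ℂ)‖⁻¹

/-- The arc which leaves the puncture with the given tangent vector at `ε = 0` (for an ordinary
point, the constant arc). At infinity the arc is `1 / (t - 1/2) = ε v`; the local parameters
`1 / (t - 1/2)` and `1 / t` agree to first order, so its tangent vector in the parameter
`1 / t` is also `v`, and with this choice `φ` carries arcs to arcs. -/
def arcFun : BasePoint → ℝ → ℂ
  | point z, _ => z.1
  | atZero v, ε => (ε : ℂ) * v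
  | atOne v, ε => 1 + (ε : ℂ) * v
  | atInfty v, ε => 1 / 2 + 1 / ((ε : ℂ) * v)

/-- The parameters of the arc of a base point. -/
abbrev Param (b : BasePoint) : Type := Ioo (0 : ℝ) b.radius

theorem radius_pos (b : BasePoint) : 0 < b.radius := by
  cases b <;> simp [radius]

theorem norm_mul_lt_one (v : ℂˣ) {ε : ℝ} (h : ε ∈ Ioo (0 : ℝ) ‖(v : ℂ)‖⁻¹) :
    0 < ‖(ε : ℂ) * v‖ ∧ ‖(ε : ℂ) * v‖ < 1 := by
  have hv : 0 < ‖(v : ℂ)‖ := by simp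
  have h2 := (lt_inv_comm₀ h.1 hv).mp h.2
  rw [norm_mul, Complex.norm_real, Real.norm_of_nonneg h.1.le]
  refine ⟨mul_pos h.1 hv, ?_⟩
  calc ε * ‖(v : ℂ)‖ < ‖(v : ℂ)‖⁻¹ * ‖(v : ℂ)‖ := mul_lt_mul_of_pos_right h.2 hv
    _ = 1 := inv_mul_cancel₀ hv.ne'

theorem arcFun_mem (b : BasePoint) (ε : b.Param) :
    b.arcFun ε.1 ≠ 0 ∧ b.arcFun ε.1 ≠ 1 := by
  obtain ⟨ε, hε⟩ := ε
  cases b with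
  | point z => exact z.2
  | atZero v =>
    obtain ⟨h0, h1⟩ := norm_mul_lt_one v hε
    refine ⟨norm_pos_iff.mp h0, fun h => ?_⟩
    simp only [arcFun] at h
    rw [h] at h1
    simp at h1
  | atOne v =>
    obtain ⟨h0, h1⟩ := norm_mul_lt_one v hε
    refine ⟨fun h => ?_, fun h => ?_⟩
    · simp only [arcFun] at h
      rw [show (ε : ℂ) * v = -1 by linear_combination h] at h1
      simp at h1
    · simp only [arcFun] at h
      rw [show (ε : ℂ) * v = 0 by linear_combination h] at h0
      simp at h0
  | atInfty v =>
    obtain ⟨h0, h1⟩ := norm_mul_lt_one v hε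
    have hne : (ε : ℂ) * v ≠ 0 := norm_pos_iff.mp h0
    refine ⟨fun h => ?_, fun h => ?_⟩
    · simp only [arcFun] at h
      have h2 : (ε : ℂ) * v = -2 := by
        linear_combination 2 * ((ε : ℂ) * v) * h - 2 * mul_one_div_cancel hne
      rw [h2] at h1
      norm_num at h1
    · simp only [arcFun] at h
      have h2 : (ε : ℂ) * v = 2 := by
        linear_combination -2 * ((ε : ℂ) * v) * h + 2 * mul_one_div_cancel hne
      rw [h2] at h1
      norm_num at h1

theorem continuous_arcFun (b : BasePoint) : Continuous fun ε : b.Param => b.arcFun ε.1 := by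
  cases b with
  | point z => exact continuous_const
  | atZero v => simp only [arcFun]; fun_prop
  | atOne v => simp only [arcFun]; fun_prop
  | atInfty v =>
    simp only [arcFun]
    refine continuous_const.add (continuous_const.div (by fun_prop) fun ε => ?_)
    exact norm_pos_iff.mp (norm_mul_lt_one v ε.2).1

/-- The arc of a base point, as a map into `ℙ¹(ℂ) ∖ {0, 1, ∞}`. -/
def arc (b : BasePoint) : C(b.Param, U) where
  toFun ε := ⟨b.arcFun ε.1, b.arcFun_mem ε⟩
  continuous_toFun := b.continuous_arcFun.subtype_mk _

/-- The midpoint of the range of parameters. -/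
def mid (b : BasePoint) : b.Param :=
  ⟨b.radius / 2, half_pos b.radius_pos, half_lt_self b.radius_pos⟩

end BasePoint

/-! ### Homotopy classes of paths between possibly tangential base points -/

/-- The straight path between two points of a real interval. -/
def seg {r : ℝ} (s t : Ioo (0 : ℝ) r) : Path s t where
  toFun u := ⟨(1 - (u : ℝ)) * s.1 + (u : ℝ) * t.1,
    (convex_Ioo (0 : ℝ) r) s.2 t.2 (sub_nonneg.mpr u.2.2) u.2.1 (by ring)⟩
  continuous_toFun := by fun_prop
  source' := by ext; simp
  target' := by ext; simp

theorem quot_eq {r : ℝ} {s t : Ioo (0 : ℝ) r} (p q : Path.Homotopic.Quotient s t) : p = q := by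
  have : ContractibleSpace (Ioo (0 : ℝ) r) := (convex_Ioo (0 : ℝ) r).contractibleSpace ⟨_, s.2⟩
  exact Subsingleton.elim _ _

/-- The class of the piece of the arc of `b` between two parameters. -/
def BasePoint.move (b : BasePoint) (s t : b.Param) :
    Path.Homotopic.Quotient (b.arc s) (b.arc t) :=
  (Path.Homotopic.Quotient.mk (seg s t)).map b.arc

/-- A homotopy class of paths in `ℙ¹(ℂ) ∖ {0, 1, ∞}` from `b` to `b'`: a family of homotopy classes
of paths from the points of the arc of `b` to the points of the arc of `b'`, compatible with
moving the end points along these arcs. -/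
@[ext]
structure PathClass (b b' : BasePoint) where
  cls : ∀ (s : b.Param) (t : b'.Param), Path.Homotopic.Quotient (b.arc s) (b'.arc t)
  compat : ∀ (s s' : b.Param) (t t' : b'.Param),
    cls s t = ((b.move s s').trans (cls s' t')).trans (b'.move t' t)

theorem map_trans_quot {X Y : Type} [TopologicalSpace X] [TopologicalSpace Y] {x y z : X}
    (p : Path.Homotopic.Quotient x y) (q : Path.Homotopic.Quotient y z) (f : C(X, Y)) :
    (p.trans q).map f = (p.map f).trans (q.map f) := by
  induction p using Path.Homotopic.Quotient.ind with | mk p =>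
  induction q using Path.Homotopic.Quotient.ind with | mk q =>
  simp only [← Path.Homotopic.Quotient.mk_trans, ← Path.Homotopic.Quotient.mk_map,
    Path.map_trans]

theorem map_symm_quot {X Y : Type} [TopologicalSpace X] [TopologicalSpace Y] {x y : X}
    (p : Path.Homotopic.Quotient x y) (f : C(X, Y)) :
    (p.symm).map f = (p.map f).symm := by
  induction p using Path.Homotopic.Quotient.ind with | mk p =>
  rfl

theorem cast_trans_quot {X : Type} [TopologicalSpace X] {x y z x' y' z' : X}
    (p : Path.Homotopic.Quotient x y) (q : Path.Homotopic.Quotient y z)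
    (hx : x' = x) (hy : y' = y) (hz : z' = z) :
    (p.cast hx hy).trans (q.cast hy hz) = (p.trans q).cast hx hz := by
  subst hx hy hz
  simp

theorem symm_trans_quot {X : Type} [TopologicalSpace X] {x y z : X}
    (p : Path.Homotopic.Quotient x y) (q : Path.Homotopic.Quotient y z) :
    (p.trans q).symm = q.symm.trans p.symm := by
  induction p using Path.Homotopic.Quotient.ind with | mk p =>
  induction q using Path.Homotopic.Quotient.ind with | mk q =>
  simp only [← Path.Homotopic.Quotient.mk_trans, ← Path.Homotopic.Quotient.mk_symm,
    Path.trans_symm]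

theorem BasePoint.move_trans (b : BasePoint) (s t u : b.Param) :
    (b.move s t).trans (b.move t u) = b.move s u := by
  rw [move, move, move, ← map_trans_quot]
  exact congrArg (fun p => Path.Homotopic.Quotient.map p b.arc) (quot_eq _ _)

theorem BasePoint.move_symm (b : BasePoint) (s t : b.Param) : (b.move s t).symm = b.move t s := by
  rw [move, move, ← map_symm_quot]
  exact congrArg (fun p => Path.Homotopic.Quotient.map p b.arc) (quot_eq _ _)

theorem BasePoint.move_self (b : BasePoint) (s : b.Param) :
    b.move s s = Path.Homotopic.Quotient.refl _ :=
  congrArg (fun p => Path.Homotopic.Quotient.map p b.arc)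
    (quot_eq (Path.Homotopic.Quotient.mk (seg s s)) (Path.Homotopic.Quotient.refl s))

namespace PathClass

/-- Composition of homotopy classes of paths, from left to right. -/
def trans {b b' b'' : BasePoint} (c : PathClass b b') (d : PathClass b' b'') :
    PathClass b b'' where
  cls s t := (c.cls s b'.mid).trans (d.cls b'.mid t)
  compat s s' t t' := by
    rw [c.compat s s' b'.mid b'.mid, d.compat b'.mid b'.mid t t', b'.move_self]
    simp [Path.Homotopic.Quotient.trans_assoc]

/-- The composition may be computed at every point of the intermediate arc. -/
theorem trans_cls {b b' b'' : BasePoint} (c : PathClass b b') (d : PathClass b' b'')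
    (s : b.Param) (u : b'.Param) (t : b''.Param) :
    (c.trans d).cls s t = (c.cls s u).trans (d.cls u t) := by
  change (c.cls s b'.mid).trans (d.cls b'.mid t) = _
  rw [c.compat s s b'.mid u, d.compat b'.mid u t t, b.move_self, b''.move_self]
  have h := b'.move_trans u b'.mid u
  rw [b'.move_self] at h
  simp only [Path.Homotopic.Quotient.refl_trans, Path.Homotopic.Quotient.trans_refl]
  rw [Path.Homotopic.Quotient.trans_assoc, ← Path.Homotopic.Quotient.trans_assoc (b'.move u _), h,
    Path.Homotopic.Quotient.refl_trans]

/-- The reverse class. -/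
def symm {b b' : BasePoint} (c : PathClass b b') : PathClass b' b where
  cls s t := (c.cls t s).symm
  compat s s' t t' := by
    rw [c.compat t t' s s', symm_trans_quot, symm_trans_quot, b.move_symm, b'.move_symm,
      Path.Homotopic.Quotient.trans_assoc]

end PathClass

/-- The base point `φ(b)`: `φ` acts on points by `t ↦ 1 - t`, it exchanges `0` and `1`, it fixes
`∞`, and its derivative at each of the three points `0`, `1`, `∞` is `-1` in the parameters
`t`, `t - 1`, `1 / t`. -/
def BasePoint.reflect : BasePoint → BasePoint
  | .point z => .point (phi z)
  | .atZero v => .atOne (-v)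
  | .atOne v => .atZero (-v)
  | .atInfty v => .atInfty (-v)

theorem BasePoint.radius_reflect (b : BasePoint) : b.reflect.radius = b.radius := by
  cases b <;> simp [reflect, radius]

/-- The parameter on the arc of `b` with the same value as the parameter `s` on the arc of
`φ(b)`. -/
def BasePoint.unreflect (b : BasePoint) (s : b.reflect.Param) : b.Param :=
  ⟨s.1, s.2.1, s.2.2.trans_eq b.radius_reflect⟩

theorem BasePoint.arcFun_reflect (b : BasePoint) (s : ℝ) :
    b.reflect.arcFun s = 1 - b.arcFun s := by
  cases b with
  | point z => rfl
  | atZero v => simp [reflect, arcFun]; ring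
  | atOne v => simp [reflect, arcFun]
  | atInfty v => simp [reflect, arcFun]; ring

theorem BasePoint.arc_reflect (b : BasePoint) (s : b.reflect.Param) :
    b.reflect.arc s = phi (b.arc (b.unreflect s)) :=
  Subtype.ext (b.arcFun_reflect s.1)

theorem BasePoint.move_reflect (b : BasePoint) (s t : b.reflect.Param) :
    b.reflect.move s t =
      ((b.move (b.unreflect s) (b.unreflect t)).map phi).cast (b.arc_reflect s)
        (b.arc_reflect t) := by
  have h : (seg s t).map b.reflect.arc.continuous =
      (((seg (b.unreflect s) (b.unreflect t)).map b.arc.continuous).map phi.continuous).cast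
        (b.arc_reflect s) (b.arc_reflect t) := by
    ext u
    exact b.arcFun_reflect _
  exact congrArg Path.Homotopic.Quotient.mk h

/-- The image `φ(γ)` of a class `γ`. -/
def PathClass.reflect {b b' : BasePoint} (c : PathClass b b') :
    PathClass b.reflect b'.reflect where
  cls s t := ((c.cls (b.unreflect s) (b'.unreflect t)).map phi).cast
    (b.arc_reflect s) (b'.arc_reflect t)
  compat s s' t t' := by
    rw [c.compat _ (b.unreflect s') _ (b'.unreflect t'), map_trans_quot, map_trans_quot,
      b.move_reflect, b'.move_reflect, cast_trans_quot, cast_trans_quot]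

/-- The tangential base point at `0` with tangent vector `1`. -/
def b01 : BasePoint := .atZero 1

/-- The tangential base point at `1` with tangent vector `-1`. -/
def b10 : BasePoint := .atOne (-1)

theorem b01_reflect : b01.reflect = b10 := rfl

theorem b10_reflect : b10.reflect = b01 := by
  simp [b01, b10, BasePoint.reflect]

theorem b01_param (s : b01.Param) : s.1 ∈ Ioo (0 : ℝ) 1 := by
  have := s.2
  simpa [b01, BasePoint.radius] using this

theorem b10_param (t : b10.Param) : 1 - t.1 ∈ Ioo (0 : ℝ) 1 := by
  have := t.2
  simp only [b10, BasePoint.radius, mem_Ioo, Units.val_neg, Units.val_one, norm_neg, norm_one,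
    inv_one] at this
  constructor <;> linarith [this.1, this.2]

/-- The inclusion of the real interval `(0, 1)`. -/
def unitIncl : C(Ioo (0 : ℝ) 1, U) where
  toFun x := ⟨((x : ℝ) : ℂ), by exact_mod_cast x.2.1.ne', by exact_mod_cast x.2.2.ne⟩
  continuous_toFun := by fun_prop

theorem arc_b01 (s : b01.Param) : b01.arc s = unitIncl ⟨s.1, b01_param s⟩ :=
  Subtype.ext (by
    change ((s.1 : ℝ) : ℂ) * ((1 : ℂˣ) : ℂ) = ((s.1 : ℝ) : ℂ)
    simp)

theorem arc_b10 (t : b10.Param) : b10.arc t = unitIncl ⟨1 - t.1, b10_param t⟩ :=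
  Subtype.ext (by
    change 1 + ((t.1 : ℝ) : ℂ) * ((-1 : ℂˣ) : ℂ) = ((1 - t.1 : ℝ) : ℂ)
    push_cast
    ring)

theorem move_b01 (s t : b01.Param) :
    b01.move s t = ((Path.Homotopic.Quotient.mk
      (seg (⟨s.1, b01_param s⟩ : Ioo (0 : ℝ) 1) ⟨t.1, b01_param t⟩)).map unitIncl).cast
        (arc_b01 s) (arc_b01 t) := by
  have h : (seg s t).map b01.arc.continuous =
      ((seg (⟨s.1, b01_param s⟩ : Ioo (0 : ℝ) 1) ⟨t.1, b01_param t⟩).map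
        unitIncl.continuous).cast (arc_b01 s) (arc_b01 t) := by
    ext u
    exact congrArg Subtype.val (arc_b01 (seg s t u))
  exact congrArg Path.Homotopic.Quotient.mk h

theorem move_b10 (s t : b10.Param) :
    b10.move s t = ((Path.Homotopic.Quotient.mk
      (seg (⟨1 - s.1, b10_param s⟩ : Ioo (0 : ℝ) 1) ⟨1 - t.1, b10_param t⟩)).map unitIncl).cast
        (arc_b10 s) (arc_b10 t) := by
  have h : (seg s t).map b10.arc.continuous =
      ((seg (⟨1 - s.1, b10_param s⟩ : Ioo (0 : ℝ) 1) ⟨1 - t.1, b10_param t⟩).map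
        unitIncl.continuous).cast (arc_b10 s) (arc_b10 t) := by
    ext u
    refine (congrArg Subtype.val (arc_b10 (seg s t u))).trans ?_
    change ((1 - ((1 - (u : ℝ)) * s.1 + (u : ℝ) * t.1) : ℝ) : ℂ) =
      (((1 - (u : ℝ)) * (1 - s.1) + (u : ℝ) * (1 - t.1) : ℝ) : ℂ)
    congr 1
    ring
  exact congrArg Path.Homotopic.Quotient.mk h

/-- The class `δ` of the straight path along the real interval `(0, 1)`: from the point `s` near
`0` to the point `1 - t` near `1` it is the class of the straight segment. -/
def delta : PathClass b01 b10 where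
  cls s t := ((Path.Homotopic.Quotient.mk
    (seg (⟨s.1, b01_param s⟩ : Ioo (0 : ℝ) 1) ⟨1 - t.1, b10_param t⟩)).map unitIncl).cast
      (arc_b01 s) (arc_b10 t)
  compat s s' t t' := by
    rw [move_b01, move_b10, cast_trans_quot, cast_trans_quot, ← map_trans_quot, ← map_trans_quot]
    exact congrArg (fun p => (Path.Homotopic.Quotient.map p unitIncl).cast _ _) (quot_eq _ _)

/-- The class `γ' = δ · φ(γ)` from `b01` to `φ(b)`. -/
def dualPath {b : BasePoint} (γ : PathClass b01 b) : PathClass b01 b.reflect :=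
  delta.trans (γ.reflect : PathClass b10 b.reflect)

/-! ### Iterated integrals -/

/-- The two differential forms `X = dt / t` and `Y = dt / (1 - t)`. -/
inductive Form where
  | X
  | Y

/-- The coefficient of `dt`. -/
def Form.coeff : Form → ℂ → ℂ
  | .X, t => 1 / t
  | .Y, t => 1 / (1 - t)

/-- The iterated integral along `f` restricted to `[0, s]`; the first letter of the word is
integrated last:
`∫_{f|[0,s]} ω w = ∫_0^s ω(f(u)) f'(u) (∫_{f|[0,u]} w) du`. -/
def iterIntegral (f : ℝ → ℂ) : List Form → ℝ → ℂ
  | [], _ => 1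
  | a :: w, s => ∫ u in (0 : ℝ)..s, a.coeff (f u) * deriv f u * iterIntegral f w u

/-- A path, viewed as a function of a real variable with values in `ℂ`. -/
def pathFun {x y : U} (p : Path x y) : ℝ → ℂ := fun s => (p.extend s : ℂ)

/-- Piecewise smooth paths. -/
def PiecewiseSmooth {x y : U} (p : Path x y) : Prop :=
  ∃ (N : ℕ) (τ : ℕ → ℝ), Monotone τ ∧ τ 0 = 0 ∧ τ N = 1 ∧
    ∀ i < N, ContDiffOn ℝ ∞ (pathFun p) (Icc (τ i) (τ (i + 1)))

/-- `I` is the iterated integral of the word `w` along the homotopy class `c`: there are piecewise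
smooth paths in `c`, and the iterated integral along each of them is `I`. -/
def IsIterIntegral {x y : U} (c : Path.Homotopic.Quotient x y) (w : List Form) (I : ℂ) : Prop :=
  (∃ p : Path x y, PiecewiseSmooth p ∧ Path.Homotopic.Quotient.mk p = c) ∧
  ∀ p : Path x y, PiecewiseSmooth p → Path.Homotopic.Quotient.mk p = c →
    iterIntegral (pathFun p) w 1 = I

/-- `L` is the regularised value of `f(ε)` as `ε → 0⁺`: up to `o(1)`, `f(ε)` is a polynomial in
`log ε` with constant term `L`. (If `f(ε)` converges, this is its limit.) -/
def HasRegValue (f : ℝ → ℂ) (L : ℂ) : Prop :=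
  ∃ P : Polynomial ℂ, P.coeff 0 = L ∧
    Tendsto (fun ε : ℝ => f ε - P.eval ((Real.log ε : ℝ) : ℂ)) (𝓝[>] (0 : ℝ)) (𝓝 0)

/-- `L` is the (regularised) iterated integral of `w` along the class `γ` between possibly tangential
base points: the regularised value, as `ε → 0⁺`, of the iterated integrals along the class
obtained from `γ` by cutting it off at the parameter `ε` on the arcs of its end points. -/
def HasIntegral {b b' : BasePoint} (γ : PathClass b b') (w : List Form) (L : ℂ) : Prop :=
  ∃ f : ℝ → ℂ,
    (∀ (ε : ℝ) (hs : ε ∈ Ioo (0 : ℝ) b.radius) (ht : ε ∈ Ioo (0 : ℝ) b'.radius),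
      IsIterIntegral (γ.cls ⟨ε, hs⟩ ⟨ε, ht⟩) w (f ε)) ∧
    HasRegValue f L

open Classical in
/-- The (regularised) iterated integral of `w` along `γ`. -/
def integral {b b' : BasePoint} (γ : PathClass b b') (w : List Form) : ℂ :=
  if h : ∃ L, HasIntegral γ w L then h.choose else 0

/-- The logarithm `log(z; γ)`, the integral of `dt / t` along `δ⁻¹ · γ`. -/
def logAlong {b : BasePoint} (γ : PathClass b01 b) : ℂ := integral (delta.symm.trans γ) [.X]

/-- The word `X^{k_d - 1} Y ⋯ X^{k_1 - 1} Y` of the multi-index `(k_1, …, k_d)`. -/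
def word (k : List ℕ) : List Form :=
  k.reverse.flatMap fun i => List.replicate (i - 1) .X ++ [.Y]

/-- The multiple polylogarithm `Li_k(z; γ)`: the integral of `(dt/t) Li_{k_1,…,k_d - 1}` if
`k_d ≠ 1`, and of `(dt/(1 - t)) Li_{k_1,…,k_{d-1}}` if `k_d = 1`. -/
def Li (k : List ℕ) {b : BasePoint} (γ : PathClass b01 b) : ℂ := integral γ (word k)

/-- The multiple zeta value `ζ(k)`. -/
def zeta (k : List ℕ) : ℂ := Li k delta

end MPL

end

/-! The iterated integrals of all words along a path form a series `Φ` with `Φ(x w)' = ω_x Φ(w)`.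
This system adds letters on the left, so a solution multiplied on the right by a constant series is
again a solution, and a solution is determined by its value at one point. Hence composition of paths
becomes the product `conv` (`classIntegral_trans`), and local holomorphic solutions give homotopy
invariance (`iterIntegral_eq_of_homotopic`).

The formula says that a certain function is constant. Put `M = m - 1` and `N = n - 1`. In the
derivative of `∑ (-Φ_X)^j / j! Φ(X^(M-j) Y^N)` all terms cancel in pairs except `(-Φ_X)^M / M! · ω_Y
· Φ_Y^(N-1) / (N-1)!` (`IsFlat.hasDerivAt_logSum`). Since `φ` exchanges `X` and `Y` up to sign, the
integrals `Ψ` along the dual path satisfy `Ψ_X = -Φ_Y` and `Ψ_Y = -Φ_X`, and the derivative of the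
dual sum is the negative of this term (`IsFlat.dualitySum_eq`). So the left hand side does not
change along `γ` (`DualPair.transport`).

The tangential start is handled by a solution `ell` on `(0, 1)` normalised at `0`: it is `log s` at
`X` and vanishes at `0` on every word containing `Y`. Transport along `γ` gives `polylog γ`. Since
`δ` carries `ell` at `u` to `ell` at `1 - t`, the dual path starts from `ell` at `1 - u` when `γ` is
cut at `u`. The constant is therefore the duality sum of `ell u` and `ell (1 - u)`. That too is
independent of `u`, and for `u → 1` only the zeta value survives (`regPolylog_delta`).

For a tangential end every function of the cut-off `ε` is a polynomial in `log ε` up to a positive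
power of `ε`. Such expansions are stable under products and under integration against a simple pole
(`HasLogExp.mul`, `HasLogExp.primitive`), and taking the constant term is a ring homomorphism, so
the identity may be regularised term by term (`dualitySum_regPolylog`). The integrals cut off at
both ends differ from `polylog` by the factor `ell` at `ε`, which for words ending in `Y` changes
nothing in the limit (`hasLogExp_conv_sub`). -/

namespace MPL

/-! ### Series in noncommuting variables -/

/-- The product of two series indexed by words, `∑_{w = uv} c(u) d(v)`. -/
def conv : (List Form → ℂ) → (List Form → ℂ) → List Form → ℂ
  | c, d, [] => c [] * d []
  | c, d, x :: w => c [] * d (x :: w) + conv (fun v => c (x :: v)) d w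

/-- The unit of the product `conv`. -/
def unitSeries : List Form → ℂ
  | [] => 1
  | _ :: _ => 0

/-- Removing the first letter from `conv c d` leaves a multiple of a shift of `d` plus a shorter
product; associativity needs linearity in exactly this shape. -/
theorem conv_add_smul (a : ℂ) (c c' d : List Form → ℂ) (w : List Form) :
    conv (fun v => a * c v + c' v) d w = a * conv c d w + conv c' d w := by
  induction w generalizing c c' with
  | nil => simp only [conv]; ring
  | cons x w ih => simp only [conv, ih]; ring

theorem conv_smul (a : ℂ) (c d : List Form → ℂ) (w : List Form) :
    conv (fun v => a * c v) d w = a * conv c d w := by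
  induction w generalizing c with
  | nil => simp only [conv]; ring
  | cons x w ih => simp only [conv, ih]; ring

theorem conv_assoc (c d e : List Form → ℂ) (w : List Form) :
    conv (conv c d) e w = conv c (conv d e) w := by
  induction w generalizing c with
  | nil => simp only [conv]; ring
  | cons x w ih =>
    have h := conv_add_smul (c []) (fun v => d (x :: v)) (conv (fun v => c (x :: v)) d) e w
    simp only [conv] at h ⊢
    rw [h, ih]
    ring

theorem conv_zero (d : List Form → ℂ) (w : List Form) : conv (fun _ => 0) d w = 0 := by
  induction w with
  | nil => simp [conv]
  | cons x w ih => simp [conv, ih]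

theorem unit_conv (d : List Form → ℂ) (w : List Form) : conv unitSeries d w = d w := by
  cases w with
  | nil => simp [conv, unitSeries]
  | cons x w => simp [conv, unitSeries, conv_zero]

theorem conv_unit (c : List Form → ℂ) (w : List Form) : conv c unitSeries w = c w := by
  induction w generalizing c with
  | nil => simp [conv, unitSeries]
  | cons x w ih => simp [conv, unitSeries, ih]

theorem continuousOn_conv {s : Set ℝ} {c : List Form → ℝ → ℂ} (d : List Form → ℂ)
    (h : ∀ w, ContinuousOn (c w) s) (w : List Form) :
    ContinuousOn (fun t => conv (fun v => c v t) d w) s := by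
  induction w generalizing c with
  | nil => exact (h []).mul_const _
  | cons x w ih => exact ((h []).mul_const _).add (ih fun v => h (x :: v))

theorem hasDerivAt_conv {c : List Form → ℝ → ℂ} {c' : List Form → ℂ} {t : ℝ} (d : List Form → ℂ)
    (h : ∀ w, HasDerivAt (c w) (c' w) t) (w : List Form) :
    HasDerivAt (fun t => conv (fun v => c v t) d w) (conv c' d w) t := by
  induction w generalizing c c' with
  | nil => exact (h []).mul_const _
  | cons x w ih => exact ((h []).mul_const _).add (ih fun v => h (x :: v))

/-! ### Flat families of functions -/

/-- The fundamental theorem of calculus tolerates a countable exceptional set when the function is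
continuous, so corners of paths need no subdivision. -/
theorem eq_left_of_hasDerivAt_zero {g : ℝ → ℂ} {S : Set ℝ} {a b : ℝ} (hS : S.Countable)
    (hc : ContinuousOn g (Icc a b)) (hd : ∀ t ∈ Ioo a b \ S, HasDerivAt g 0 t) {t : ℝ}
    (ht : t ∈ Icc a b) : g t = g a := by
  have h := MeasureTheory.integral_eq_of_hasDerivAt_off_countable_of_le g (fun _ => 0) ht.1 hS
    (hc.mono (Icc_subset_Icc_right ht.2))
    (fun u hu => hd u ⟨⟨hu.1.1, hu.1.2.trans_le ht.2⟩, hu.2⟩) (by simp)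
  simp only [intervalIntegral.integral_zero] at h
  exact (sub_eq_zero.mp h.symm)

/-- A family of functions on `[a, b]`, indexed by words, which solves `Φ(x w)' = k(x) Φ(w)` outside
an exceptional set `S`. -/
structure IsFlat (k : Form → ℝ → ℂ) (S : Set ℝ) (a b : ℝ) (Φ : List Form → ℝ → ℂ) : Prop where
  nil : ∀ t ∈ Icc a b, Φ [] t = 1
  cont : ∀ w, ContinuousOn (Φ w) (Icc a b)
  deriv : ∀ x w, ∀ t ∈ Ioo a b \ S, HasDerivAt (Φ (x :: w)) (k x t * Φ w t) t

namespace IsFlat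

variable {k : Form → ℝ → ℂ} {S : Set ℝ} {a b : ℝ} {Φ Ψ : List Form → ℝ → ℂ}

theorem mono {T : Set ℝ} {a' b' : ℝ} (h : IsFlat k S a b Φ) (hS : S ⊆ T) (ha : a ≤ a')
    (hb : b' ≤ b) : IsFlat k T a' b' Φ where
  nil t ht := h.nil t ⟨ha.trans ht.1, ht.2.trans hb⟩
  cont w := (h.cont w).mono (Icc_subset_Icc ha hb)
  deriv x w t ht := h.deriv x w t ⟨⟨ha.trans_lt ht.1.1, ht.1.2.trans_le hb⟩, fun hs => ht.2 (hS hs)⟩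

theorem congr_coeff {k' : Form → ℝ → ℂ} (h : IsFlat k S a b Φ)
    (hk : ∀ x, ∀ t ∈ Ioo a b \ S, k x t = k' x t) : IsFlat k' S a b Φ where
  nil := h.nil
  cont := h.cont
  deriv x w t ht := hk x t ht ▸ h.deriv x w t ht

/-- The system is triangular: the derivative at a word involves only the shorter word, where the two
solutions already agree. -/
theorem unique (hS : S.Countable) (hΦ : IsFlat k S a b Φ) (hΨ : IsFlat k S a b Ψ)
    (h0 : ∀ w, Φ w a = Ψ w a) (w : List Form) {t : ℝ} (ht : t ∈ Icc a b) : Φ w t = Ψ w t := by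
  induction w generalizing t with
  | nil => rw [hΦ.nil t ht, hΨ.nil t ht]
  | cons x w ih =>
    have := eq_left_of_hasDerivAt_zero (g := fun t => Φ (x :: w) t - Ψ (x :: w) t) hS
      ((hΦ.cont _).sub (hΨ.cont _)) (fun u hu => by
        have := (hΦ.deriv x w u hu).sub (hΨ.deriv x w u hu)
        rwa [ih (Ioo_subset_Icc_self hu.1), sub_self] at this) ht
    simpa [h0, sub_eq_zero] using this

theorem hasDerivAt_nil (h : IsFlat k S a b Φ) {t : ℝ} (ht : t ∈ Ioo a b) :
    HasDerivAt (Φ []) 0 t :=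
  (hasDerivAt_const t (1 : ℂ)).congr_of_eventuallyEq <| by
    filter_upwards [isOpen_Ioo.mem_nhds ht] with u hu using h.nil u (Ioo_subset_Icc_self hu)

/-- The equation acts on the first letter of a word, hence commutes with right multiplication by a
constant series. This is how initial values other than the unit series enter. -/
theorem conv (h : IsFlat k S a b Φ) {d : List Form → ℂ} (hd : d [] = 1) :
    IsFlat k S a b fun w t => MPL.conv (fun v => Φ v t) d w where
  nil t ht := by simp [MPL.conv, h.nil t ht, hd]
  cont := continuousOn_conv d h.cont
  deriv x w t ht := by
    have h1 := hasDerivAt_conv d (fun v => h.deriv x v t ht) w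
    rw [conv_smul] at h1
    exact (((h.hasDerivAt_nil ht.1).mul_const (d (x :: w))).add h1).congr_deriv (by simp)

theorem comp_affine (h : IsFlat k S a b Φ) {c : ℝ} (hc : 0 < c) (e : ℝ) {a' b' : ℝ}
    (ha : c * a' + e = a) (hb : c * b' + e = b) :
    IsFlat (fun x t => c * k x (c * t + e)) ((fun t => c * t + e) ⁻¹' S) a' b'
      fun w t => Φ w (c * t + e) where
  nil t ht := h.nil _ ⟨by nlinarith [ht.1], by nlinarith [ht.2]⟩
  cont w := (h.cont w).comp (by fun_prop) fun t ht => ⟨by nlinarith [ht.1], by nlinarith [ht.2]⟩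
  deriv x w t ht := by
    have h1 : HasDerivAt (fun t => c * t + e) c t := by
      simpa using ((hasDerivAt_id t).const_mul c).add_const e
    have h2 := (h.deriv x w (c * t + e)
      ⟨⟨by nlinarith [ht.1.1], by nlinarith [ht.1.2]⟩, ht.2⟩).scomp t h1
    exact h2.congr_deriv (by rw [Complex.real_smul]; ring)

end IsFlat

/-! ### Iterated integrals along regular paths -/

/-- The regularity of paths that is used in the computation of iterated integrals: `f` is
continuous, and continuously differentiable on `(0, 1)` outside a countable set, with integrable
derivative. -/
structure RegularPath (f : ℝ → ℂ) (S : Set ℝ) : Prop where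
  cont : Continuous f
  countable : S.Countable
  diff : ∀ t ∈ Ioo (0 : ℝ) 1 \ S, DifferentiableAt ℝ f t
  derivCont : ∀ t ∈ Ioo (0 : ℝ) 1 \ S, ContinuousAt (deriv f) t
  int : IntervalIntegrable (deriv f) MeasureTheory.volume 0 1
  mem : ∀ t, f t ≠ 0 ∧ f t ≠ 1

/-- The coefficients of the pull-backs of the forms along a path. -/
noncomputable def pullCoeff (f : ℝ → ℂ) (x : Form) (t : ℝ) : ℂ := x.coeff (f t) * deriv f t

theorem Form.continuousAt_coeff (x : Form) {z : ℂ} (h : z ≠ 0 ∧ z ≠ 1) :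
    ContinuousAt x.coeff z := by
  cases x with
  | X => exact continuousAt_const.div continuousAt_id h.1
  | Y => exact continuousAt_const.div (by fun_prop) (sub_ne_zero.mpr h.2.symm)

theorem Form.differentiableAt_coeff (x : Form) {z : ℂ} (h : z ≠ 0 ∧ z ≠ 1) :
    DifferentiableAt ℂ x.coeff z := by
  cases x with
  | X => exact (differentiableAt_const _).div differentiableAt_id h.1
  | Y => exact (differentiableAt_const _).div (by fun_prop) (sub_ne_zero.mpr h.2.symm)

theorem RegularPath.isFlat {f : ℝ → ℂ} {S : Set ℝ} (hf : RegularPath f S) :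
    IsFlat (pullCoeff f) S 0 1 (iterIntegral f) := by
  have key : ∀ w, ContinuousOn (iterIntegral f w) (Icc 0 1) ∧
      ∀ x, IntervalIntegrable (fun u => pullCoeff f x u * iterIntegral f w u)
        MeasureTheory.volume 0 1 ∧ ContinuousOn (iterIntegral f (x :: w)) (Icc 0 1) := by
    intro w
    have aux : ∀ w, ContinuousOn (iterIntegral f w) (Icc 0 1) →
      ∀ x, IntervalIntegrable (fun u => pullCoeff f x u * iterIntegral f w u)
        MeasureTheory.volume 0 1 ∧ ContinuousOn (iterIntegral f (x :: w)) (Icc 0 1) := by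
      intro w hw x
      have h1 : IntervalIntegrable (fun u => pullCoeff f x u * iterIntegral f w u)
          MeasureTheory.volume 0 1 := by
        have h2 : ContinuousOn (fun u => x.coeff (f u) * iterIntegral f w u) (uIcc 0 1) := by
          rw [uIcc_of_le zero_le_one]
          refine ContinuousOn.mul (fun u _ => ?_) hw
          exact ((x.continuousAt_coeff (hf.mem u)).comp hf.cont.continuousAt).continuousWithinAt
        refine (hf.int.mul_continuousOn h2).congr fun u _ => ?_
        simp only [pullCoeff]
        ring
      refine ⟨h1, ?_⟩
      have h3 := intervalIntegral.continuousOn_primitive_interval' h1 (left_mem_uIcc)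
      rw [uIcc_of_le zero_le_one] at h3
      exact h3
    have : ContinuousOn (iterIntegral f w) (Icc 0 1) := by
      induction w with
      | nil => exact continuousOn_const
      | cons x w ih => exact (aux w ih x).2
    exact ⟨this, aux w this⟩
  refine ⟨fun _ _ => rfl, fun w => (key w).1, fun x w t ht => ?_⟩
  have hi := ((key w).2 x).1
  have hsub : IntervalIntegrable (fun u => pullCoeff f x u * iterIntegral f w u)
      MeasureTheory.volume 0 t :=
    hi.mono_set (by
      rw [uIcc_of_le zero_le_one, uIcc_of_le ht.1.1.le]
      exact Icc_subset_Icc_right ht.1.2.le)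
  have hmeas : StronglyMeasurableAtFilter (fun u => pullCoeff f x u * iterIntegral f w u) (𝓝 t) :=
    ⟨_, Ioc_mem_nhds ht.1.1 ht.1.2, hi.1.aestronglyMeasurable⟩
  refine intervalIntegral.integral_hasDerivAt_right hsub hmeas (ContinuousAt.mul ?_ ?_)
  · exact ((x.continuousAt_coeff (hf.mem t)).comp hf.cont.continuousAt).mul (hf.derivCont t ht)
  · exact (key w).1.continuousAt (Icc_mem_nhds ht.1.1 ht.1.2)

theorem iterIntegral_zero (f : ℝ → ℂ) (w : List Form) : iterIntegral f w 0 = unitSeries w := by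
  cases w <;> simp [iterIntegral, unitSeries]

theorem continuous_pathFun {x y : U} (p : Path x y) : Continuous (pathFun p) :=
  continuous_subtype_val.comp p.continuous_extend

theorem pathFun_mem {x y : U} (p : Path x y) (t : ℝ) : pathFun p t ≠ 0 ∧ pathFun p t ≠ 1 :=
  (p.extend t).2

theorem pathFun_zero {x y : U} (p : Path x y) : pathFun p 0 = x := by simp [pathFun]

theorem pathFun_one {x y : U} (p : Path x y) : pathFun p 1 = y := by simp [pathFun]

theorem PiecewiseSmooth.regularPath {x y : U} {p : Path x y} (hp : PiecewiseSmooth p) :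
    ∃ S, RegularPath (pathFun p) S := by
  obtain ⟨N, τ, hτ, h0, h1, hs⟩ := hp
  have hloc : ∀ t ∈ Ioo (0 : ℝ) 1 \ range τ, ContDiffAt ℝ ∞ (pathFun p) t := by
    intro t ht
    -- The least such `i` locates the piece containing `t`; it is positive because `τ 0 = 0`.
    have hex : ∃ i, t < τ i := ⟨N, h1 ▸ ht.1.2⟩
    classical
    have hi := Nat.find_spec hex
    obtain ⟨i, hi'⟩ : ∃ i, Nat.find hex = i + 1 := by
      refine Nat.exists_eq_succ_of_ne_zero fun h => ?_
      rw [h, h0] at hi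
      exact (ht.1.1.trans hi).false
    have hlt : ¬ t < τ i := Nat.find_min hex (by omega)
    rw [hi'] at hi
    have hiN : i < N := by
      by_contra h
      exact hlt (ht.1.2.trans_le (h1 ▸ hτ (not_lt.mp h)))
    have hne : τ i ≠ t := fun h => ht.2 ⟨i, h⟩
    exact (hs i hiN).contDiffAt (Icc_mem_nhds (lt_of_le_of_ne (not_lt.mp hlt) hne) hi)
  refine ⟨range τ, continuous_pathFun p, countable_range τ, fun t ht => ?_, fun t ht => ?_, ?_,
    pathFun_mem p⟩
  · exact (hloc t ht).differentiableAt (by simp)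
  · exact ((hloc t ht).derivWithin (m := 0) (by simp)).continuousAt
  · rw [← h0, ← h1]
    refine IntervalIntegrable.trans_iterate fun i hi => ?_
    -- Subdivision points may coincide, and a degenerate piece has no unique derivative within it.
    rcases (hτ i.le_succ).eq_or_lt with h | h
    · rw [h]
    · have hcont : ContinuousOn (derivWithin (pathFun p) (Icc (τ i) (τ (i + 1))))
          (uIcc (τ i) (τ (i + 1))) := by
        rw [uIcc_of_le h.le]
        exact (hs i hi).continuousOn_derivWithin (uniqueDiffOn_Icc h) (by simp)
      refine hcont.intervalIntegrable.congr_uIoo fun t ht => ?_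
      replace ht : t ∈ Ioo (τ i) (τ (i + 1)) := by rwa [uIoo_of_lt h] at ht
      exact derivWithin_of_mem_nhds (Icc_mem_nhds ht.1 ht.2)

/-- A regular path from a continuously differentiable function. -/
theorem RegularPath.of_hasDerivAt {f g g' : ℝ → ℂ} (hf : Continuous f)
    (hmem : ∀ t, f t ≠ 0 ∧ f t ≠ 1) (heq : ∀ t ∈ Icc (0 : ℝ) 1, f t = g t)
    (hg : ∀ t ∈ Icc (0 : ℝ) 1, HasDerivAt g (g' t) t) (hg' : ContinuousOn g' (Icc 0 1)) :
    RegularPath f ∅ ∧ ∀ t ∈ Ioo (0 : ℝ) 1, deriv f t = g' t := by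
  have h1 : ∀ t ∈ Ioo (0 : ℝ) 1, HasDerivAt f (g' t) t := fun t ht =>
    (hg t (Ioo_subset_Icc_self ht)).congr_of_eventuallyEq <| by
      filter_upwards [isOpen_Ioo.mem_nhds ht] with u hu using heq u (Ioo_subset_Icc_self hu)
  refine ⟨⟨hf, countable_empty, fun t ht => (h1 t ht.1).differentiableAt, fun t ht => ?_, ?_,
    hmem⟩, fun t ht => (h1 t ht).deriv⟩
  · refine (hg'.continuousAt (Icc_mem_nhds ht.1.1 ht.1.2)).congr ?_
    filter_upwards [isOpen_Ioo.mem_nhds ht.1] with u hu using (h1 u hu).deriv.symm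
  · rw [← uIcc_of_le zero_le_one] at hg'
    refine hg'.intervalIntegrable.congr_uIoo fun t ht => ?_
    rw [uIoo_of_le zero_le_one] at ht
    exact (h1 t ht).deriv.symm

/-! ### The duality identity for flat families -/

theorem hasDerivAt_pow_div_factorial {g : ℝ → ℂ} {g' : ℂ} {t : ℝ} (h : HasDerivAt g g' t) (j : ℕ) :
    HasDerivAt (fun t => g t ^ (j + 1) / ((j + 1).factorial : ℂ))
      (g t ^ j / (j.factorial : ℂ) * g') t := by
  refine ((h.pow (j + 1)).div_const _).congr_deriv ?_
  have h1 : (j.factorial : ℂ) ≠ 0 := by exact_mod_cast j.factorial_ne_zero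
  have h2 : ((j : ℂ) + 1) ≠ 0 := by exact_mod_cast j.succ_ne_zero
  rw [Nat.factorial_succ]
  push_cast
  field_simp

/-- Both sides have the same derivative, by induction on `n`. The identity at the left end has to be
assumed, since the family need not start at the unit series. -/
theorem IsFlat.replicate {k : Form → ℝ → ℂ} {S : Set ℝ} {a b : ℝ} {Φ : List Form → ℝ → ℂ}
    (h : IsFlat k S a b Φ) (hS : S.Countable) (x : Form)
    (h0 : ∀ n, Φ (List.replicate n x) a = Φ [x] a ^ n / (n.factorial : ℂ)) (n : ℕ) {t : ℝ}
    (ht : t ∈ Icc a b) : Φ (List.replicate n x) t = Φ [x] t ^ n / (n.factorial : ℂ) := by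
  induction n generalizing t with
  | zero => simp [h.nil t ht]
  | succ n ih =>
    have := eq_left_of_hasDerivAt_zero
      (g := fun t => Φ (List.replicate (n + 1) x) t - Φ [x] t ^ (n + 1) / ((n + 1).factorial : ℂ))
      hS ((h.cont _).sub (((h.cont _).pow _).div_const _)) (fun u hu => by
        have hu' := Ioo_subset_Icc_self hu.1
        have h1 := h.deriv x [] u hu
        rw [h.nil u hu', mul_one] at h1
        refine ((h.deriv x _ u hu).sub (hasDerivAt_pow_div_factorial h1 n)).congr_deriv ?_
        rw [ih hu']
        ring) ht
    simpa [h0, sub_eq_zero] using this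

/-- The sum `∑ (-log)^j / j! · Li_{w_j}` with `w_j = X^{M - j} v`. -/
noncomputable def logSum (c : List Form → ℂ) (M : ℕ) (v : List Form) : ℂ :=
  ∑ j ∈ Finset.range (M + 1),
    (-c [.X]) ^ j / (j.factorial : ℂ) * c (List.replicate (M - j) .X ++ v)

/-- Differentiating the power of the logarithm in the term `j + 1` cancels the derivative of the
leading `X` in the term `j`, so only the derivative of the factor `Φ v` of the last term remains.
That derivative is an arbitrary `d`, so that `v` may be empty. -/
theorem IsFlat.hasDerivAt_logSum {k : Form → ℝ → ℂ} {S : Set ℝ} {a b : ℝ}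
    {Φ : List Form → ℝ → ℂ} (h : IsFlat k S a b Φ) (M : ℕ) (v : List Form) {t : ℝ}
    (ht : t ∈ Ioo a b \ S) {d : ℂ} (hd : HasDerivAt (Φ v) d t) :
    HasDerivAt (fun t => logSum (fun w => Φ w t) M v)
      ((-Φ [.X] t) ^ M / (M.factorial : ℂ) * d) t := by
  have hX : HasDerivAt (fun t => -Φ [.X] t) (-k .X t) t := by
    have h1 := h.deriv .X [] t ht
    rw [h.nil t (Ioo_subset_Icc_self ht.1), mul_one] at h1
    exact h1.neg
  set e : ℕ → ℂ := fun j => (-Φ [.X] t) ^ j / (j.factorial : ℂ) with he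
  -- `g j` is minus the contribution of the logarithm in the term `j`; it vanishes at `j = 0`, which
  -- makes the telescoping sum equal to `g M`.
  set g : ℕ → ℂ := fun j => Nat.casesOn j 0 fun i =>
    k .X t * e i * Φ (List.replicate (M - (i + 1)) .X ++ v) t with hg
  have hterm : ∀ j (c : ℂ), HasDerivAt (Φ (List.replicate (M - j) .X ++ v)) c t →
      HasDerivAt (fun t => (-Φ [.X] t) ^ j / (j.factorial : ℂ) *
        Φ (List.replicate (M - j) .X ++ v) t) (e j * c - g j) t := by
    intro j c hc
    cases j with
    | zero => simpa [he, hg] using hc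
    | succ i =>
      refine ((hasDerivAt_pow_div_factorial hX i).mul hc).congr_deriv ?_
      simp only [he, hg]
      ring
  unfold logSum
  simp only [Finset.sum_range_succ _ M]
  have hlast := hterm M d (by simpa using hd)
  have hsum : HasDerivAt (fun t => ∑ j ∈ Finset.range M, (-Φ [.X] t) ^ j / (j.factorial : ℂ) *
      Φ (List.replicate (M - j) .X ++ v) t) (∑ j ∈ Finset.range M, (g (j + 1) - g j)) t := by
    refine HasDerivAt.fun_sum fun j hj => ?_
    have hj' : M - j = (M - (j + 1)) + 1 := by have := Finset.mem_range.mp hj; omega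
    have h1 := h.deriv .X (List.replicate (M - (j + 1)) .X ++ v) t ht
    rw [← List.cons_append, ← List.replicate_succ, ← hj'] at h1
    refine (hterm j _ h1).congr_deriv ?_
    simp only [hg]
    ring
  rw [Finset.sum_range_sub] at hsum
  refine (hsum.add hlast).congr_deriv ?_
  simp [hg, he]

/-- The left hand side of the duality-reflection formula in terms of the values `c` and `d` of the
iterated integrals along a path and its dual. -/
noncomputable def dualitySum (c d : List Form → ℂ) (M N : ℕ) : ℂ :=
  logSum c M (List.replicate N .Y) +
    (logSum d N (List.replicate M .Y) -
      (-d [.X]) ^ N / (N.factorial : ℂ) * d (List.replicate M .Y))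

/-- The algebraic relations between the iterated integrals along a path and its dual that involve
words in one letter. -/
structure DualPair (c d : List Form → ℂ) : Prop where
  left : ∀ n, c (List.replicate n .Y) = c [.Y] ^ n / (n.factorial : ℂ)
  right : ∀ n, d (List.replicate n .Y) = d [.Y] ^ n / (n.factorial : ℂ)
  X_eq : d [.X] = -c [.Y]
  Y_eq : d [.Y] = -c [.X]

section

variable {k l : Form → ℝ → ℂ} {S : Set ℝ} {a b : ℝ} {Φ Ψ : List Form → ℝ → ℂ}

theorem IsFlat.dualPair (hΦ : IsFlat k S a b Φ) (hΨ : IsFlat l S a b Ψ) (hS : S.Countable)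
    (hX : ∀ t ∈ Ioo a b \ S, l .X t = -k .Y t) (hY : ∀ t ∈ Ioo a b \ S, l .Y t = -k .X t)
    (h0 : DualPair (fun w => Φ w a) fun w => Ψ w a) {t : ℝ} (ht : t ∈ Icc a b) :
    DualPair (fun w => Φ w t) fun w => Ψ w t := by
  have aux : ∀ x y, (∀ t ∈ Ioo a b \ S, l x t = -k y t) → Ψ [x] a = -Φ [y] a →
      Ψ [x] t = -Φ [y] t := by
    intro x y hxy hxy0
    have := eq_left_of_hasDerivAt_zero (g := fun t => Ψ [x] t + Φ [y] t) hS
      ((hΨ.cont _).add (hΦ.cont _)) (fun u hu => by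
        refine ((hΨ.deriv x [] u hu).add (hΦ.deriv y [] u hu)).congr_deriv ?_
        rw [hxy u hu, hΦ.nil u (Ioo_subset_Icc_self hu.1), hΨ.nil u (Ioo_subset_Icc_self hu.1)]
        ring) ht
    rw [hxy0, neg_add_cancel] at this
    exact eq_neg_of_add_eq_zero_left this
  exact ⟨fun n => hΦ.replicate hS .Y h0.left n ht, fun n => hΨ.replicate hS .Y h0.right n ht,
    aux .X .Y hX h0.X_eq, aux .Y .X hY h0.Y_eq⟩

/-- The two surviving derivatives are `(-Φ_X)^M / M! · k_Y · Φ_Y^N / N!` and `-(-Ψ_X)^N / N! · k_Y ·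
Ψ_Y^M / M!`. They cancel because `Ψ_X = -Φ_Y` and `Ψ_Y = -Φ_X`. -/
theorem IsFlat.dualitySum_eq (hΦ : IsFlat k S a b Φ) (hΨ : IsFlat l S a b Ψ) (hS : S.Countable)
    (hX : ∀ t ∈ Ioo a b \ S, l .X t = -k .Y t) (hY : ∀ t ∈ Ioo a b \ S, l .Y t = -k .X t)
    (h0 : DualPair (fun w => Φ w a) fun w => Ψ w a) (M N : ℕ) {t : ℝ} (ht : t ∈ Icc a b) :
    dualitySum (fun w => Φ w t) (fun w => Ψ w t) M (N + 1) =
      dualitySum (fun w => Φ w a) (fun w => Ψ w a) M (N + 1) := by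
  refine eq_left_of_hasDerivAt_zero
    (g := fun t => dualitySum (fun w => Φ w t) (fun w => Ψ w t) M (N + 1)) hS ?_ ?_ ht
  · unfold dualitySum logSum
    have := hΦ.cont
    have := hΨ.cont
    fun_prop
  · intro u hu
    have hu' := Ioo_subset_Icc_self hu.1
    have hp := hΦ.dualPair hΨ hS hX hY h0 hu'
    -- Only existence matters: `d` occurs in the derivative of the full sum and in that of the
    -- subtracted last term, and drops out.
    have hΨY : ∃ d, HasDerivAt (Ψ (List.replicate M .Y)) d u := by
      cases M with
      | zero => exact ⟨0, hΨ.hasDerivAt_nil hu.1⟩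
      | succ M => exact ⟨_, hΨ.deriv .Y _ u hu⟩
    obtain ⟨d, hd⟩ := hΨY
    have h1 := hΦ.hasDerivAt_logSum M (List.replicate (N + 1) .Y) hu (hΦ.deriv .Y _ u hu)
    have h2 := hΨ.hasDerivAt_logSum (N + 1) (List.replicate M .Y) hu hd
    have h3 : HasDerivAt (fun t => -Ψ [.X] t) (k .Y u) u := by
      refine (hΨ.deriv .X [] u hu).neg.congr_deriv ?_
      rw [hΨ.nil u hu', hX u hu]
      ring
    refine (h1.add (h2.sub ((hasDerivAt_pow_div_factorial h3 N).mul hd))).congr_deriv ?_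
    have e1 := hp.left N
    have e2 := hp.right M
    have e3 := hp.X_eq
    have e4 := hp.Y_eq
    rw [e1, e2, e4, e3]
    ring

end

/-! ### Local solutions and homotopy invariance -/

/-- A family of holomorphic functions on `D`, indexed by words, which solves
`dG(x w) = ω_x G(w)`. -/
structure IsSolution (D : Set ℂ) (G : List Form → ℂ → ℂ) : Prop where
  nil : ∀ z, G [] z = 1
  deriv : ∀ x w, ∀ z ∈ D, HasDerivAt (G (x :: w)) (x.coeff z * G w z) z

/-- Holomorphic functions on a disc have primitives, and the constants of integration can be
prescribed word by word. -/
theorem exists_isSolution {z₀ : ℂ} {r : ℝ} (hD : ∀ z ∈ Metric.ball z₀ r, z ≠ 0 ∧ z ≠ 1) (x₀ : ℂ)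
    (c : List Form → ℂ) (hc : c [] = 1) :
    ∃ G, IsSolution (Metric.ball z₀ r) G ∧ ∀ w, G w x₀ = c w := by
  -- Holomorphy is bundled with the function, so that the chosen primitive can be fed into the next
  -- step of the recursion over words.
  have hex : ∀ (x : Form) (w : List Form) (g : {g // DifferentiableOn ℂ g (Metric.ball z₀ r)}),
      ∃ h : {g // DifferentiableOn ℂ g (Metric.ball z₀ r)}, h.1 x₀ = c (x :: w) ∧
        ∀ z ∈ Metric.ball z₀ r, HasDerivAt h.1 (x.coeff z * g.1 z) z := by
    intro x w g
    have hdiff : DifferentiableOn ℂ (fun z => x.coeff z * g.1 z) (Metric.ball z₀ r) :=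
      fun z hz => ((x.differentiableAt_coeff (hD z hz)).differentiableWithinAt).mul (g.2 z hz)
    obtain ⟨h, h1, h2⟩ := hdiff.isExactOn_ball.with_val_at x₀ (c (x :: w))
    exact ⟨⟨h, fun z hz => (h2 z hz).differentiableAt.differentiableWithinAt⟩, h1, h2⟩
  choose step hval hder using hex
  let G : List Form → {g // DifferentiableOn ℂ g (Metric.ball z₀ r)} := fun w =>
    List.rec ⟨fun _ => 1, differentiableOn_const _⟩ (fun x w g => step x w g) w
  refine ⟨fun w => (G w).1, ⟨fun _ => rfl, fun x w z hz => hder x w (G w) z hz⟩, fun w => ?_⟩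
  cases w with
  | nil => exact hc.symm
  | cons x w => exact hval x w (G w)

namespace IsSolution

variable {D : Set ℂ} {G G' : List Form → ℂ → ℂ}

theorem mono {E : Set ℂ} (h : IsSolution D G) (hE : E ⊆ D) : IsSolution E G :=
  ⟨h.nil, fun x w z hz => h.deriv x w z (hE hz)⟩

theorem unique (hG : IsSolution D G) (hG' : IsSolution D G') (hD : IsOpen D)
    (hconn : IsPreconnected D) {z₀ : ℂ} (hz₀ : z₀ ∈ D) (h0 : ∀ w, G w z₀ = G' w z₀)
    (w : List Form) {z : ℂ} (hz : z ∈ D) : G w z = G' w z := by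
  induction w generalizing z with
  | nil => rw [hG.nil, hG'.nil]
  | cons x w ih =>
    have hd : ∀ u ∈ D, HasDerivAt (fun u => G (x :: w) u - G' (x :: w) u) 0 u := fun u hu => by
      refine ((hG.deriv x w u hu).sub (hG'.deriv x w u hu)).congr_deriv ?_
      rw [ih hu, sub_self]
    have := hD.is_const_of_deriv_eq_zero hconn
      (fun u hu => (hd u hu).differentiableAt.differentiableWithinAt)
      (fun u hu => (hd u hu).deriv) hz hz₀
    simpa [h0, sub_eq_zero] using this

theorem continuousOn (h : IsSolution D G) (w : List Form) : ContinuousOn (G w) D := by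
  cases w with
  | nil => exact continuousOn_const.congr fun z _ => h.nil z
  | cons x w => exact fun z hz => (h.deriv x w z hz).continuousAt.continuousWithinAt

theorem isFlat_comp (h : IsSolution D G) {f : ℝ → ℂ} {S : Set ℝ} (hf : RegularPath f S) {a b : ℝ}
    (ha : 0 ≤ a) (hb : b ≤ 1) (hfD : ∀ t ∈ Icc a b, f t ∈ D) :
    IsFlat (pullCoeff f) S a b fun w t => G w (f t) where
  nil _ _ := h.nil _
  cont w := (h.continuousOn w).comp hf.cont.continuousOn hfD
  deriv x w t ht := by
    have h1 := h.deriv x w (f t) (hfD t (Ioo_subset_Icc_self ht.1))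
    have h2 := (hf.diff t ⟨⟨ha.trans_lt ht.1.1, ht.1.2.trans_le hb⟩, ht.2⟩).hasDerivAt
    refine (h1.comp t h2).congr_deriv ?_
    rw [pullCoeff]
    ring

end IsSolution

/-- Uniformly close paths with the same end points have the same iterated integrals. -/
theorem iterIntegral_eq_of_close {f g : ℝ → ℂ} {S T : Set ℝ} (hf : RegularPath f S)
    (hg : RegularPath g T) {δ : ℝ} (hδ : 0 < δ)
    (hball : ∀ t ∈ Icc (0 : ℝ) 1, ∀ z ∈ Metric.ball (f t) δ, z ≠ 0 ∧ z ≠ 1)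
    (hclose : ∀ t ∈ Icc (0 : ℝ) 1, dist (g t) (f t) < δ / 2) (h0 : g 0 = f 0) (h1 : g 1 = f 1)
    (w : List Form) : iterIntegral f w 1 = iterIntegral g w 1 := by
  -- On each piece of a subdivision of mesh below `η`, `f` moves by less than `δ / 2`; as `g` is `δ
  -- / 2`-close to `f`, both stay in one ball of radius `δ`.
  obtain ⟨η, hη, hunif⟩ := Metric.uniformContinuousOn_iff.mp
    (isCompact_Icc.uniformContinuousOn_of_continuous (hf.cont.continuousOn (s := Icc (0 : ℝ) 1)))
    (δ / 2) (half_pos hδ)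
  obtain ⟨n, hn⟩ := exists_nat_one_div_lt hη
  have hn0 : (0 : ℝ) < n + 1 := by positivity
  have hmem : ∀ i ≤ n + 1, ((i : ℝ) / (n + 1)) ∈ Icc (0 : ℝ) 1 := fun i hi =>
    ⟨by positivity, (div_le_one hn0).mpr (by exact_mod_cast hi)⟩
  -- The invariant: one local solution `G` computes both integrals at the subdivision point, each at
  -- its own position. At the common end point the two values then coincide.
  have key : ∀ i ≤ n + 1, ∃ G, IsSolution (Metric.ball (f (i / (n + 1))) δ) G ∧
      ∀ w, iterIntegral f w (i / (n + 1)) = G w (f (i / (n + 1))) ∧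
        iterIntegral g w (i / (n + 1)) = G w (g (i / (n + 1))) := by
    intro i
    induction i with
    | zero =>
      intro _
      obtain ⟨G, hG, hG0⟩ := exists_isSolution (hball 0 (by simp)) (f 0) unitSeries rfl
      exact ⟨G, by simpa using hG, fun w => by simp [iterIntegral_zero, h0, hG0]⟩
    | succ i ih =>
      intro hi
      obtain ⟨G, hG, hGi⟩ := ih (by omega)
      have hs := hmem i (by omega)
      have hs' := hmem (i + 1) hi
      set s : ℝ := (i : ℝ) / (n + 1)
      set s' : ℝ := ((i + 1 : ℕ) : ℝ) / (n + 1) with hs'_def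
      have hss : s' - s = 1 / (n + 1) := by
        rw [hs'_def, ← sub_div]
        push_cast
        ring
      have hle : s ≤ s' := by
        have : 0 ≤ s' - s := by rw [hss]; positivity
        linarith
      have hfD : ∀ t ∈ Icc s s', dist (f t) (f s) < δ / 2 := fun t ht => by
        refine hunif t ⟨hs.1.trans ht.1, ht.2.trans hs'.2⟩ s hs ?_
        rw [Real.dist_eq, abs_of_nonneg (by linarith [ht.1])]
        linarith [ht.2]
      have hgD : ∀ t ∈ Icc s s', g t ∈ Metric.ball (f s) δ := fun t ht => by
        have := hclose t ⟨hs.1.trans ht.1, ht.2.trans hs'.2⟩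
        have h3 := dist_triangle (g t) (f t) (f s)
        rw [Metric.mem_ball]
        linarith [hfD t ht]
      have e1 : ∀ w, iterIntegral f w s' = G w (f s') := fun w =>
        (hf.isFlat.mono subset_rfl hs.1 hs'.2).unique hf.countable
          (hG.isFlat_comp hf hs.1 hs'.2
            fun t ht => Metric.mem_ball.mpr ((hfD t ht).trans (half_lt_self hδ)))
          (fun w => (hGi w).1) w (right_mem_Icc.mpr hle)
      have e2 : ∀ w, iterIntegral g w s' = G w (g s') := fun w =>
        (hg.isFlat.mono subset_rfl hs.1 hs'.2).unique hg.countable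
          (hG.isFlat_comp hg hs.1 hs'.2 hgD)
          (fun w => (hGi w).2) w (right_mem_Icc.mpr hle)
      -- The solution on the next ball is normalised to agree with `G` at `f s'`. Two balls meet in
      -- a convex set, so `G` and `G'` also agree at `g s'`.
      obtain ⟨G', hG', hG'0⟩ := exists_isSolution (hball s' hs') (f s') (fun w => G w (f s'))
        (hG.nil _)
      refine ⟨G', hG', fun w => ⟨by rw [e1, hG'0], ?_⟩⟩
      rw [e2]
      have hr := right_mem_Icc.mpr hle
      refine IsSolution.unique (D := Metric.ball (f s) δ ∩ Metric.ball (f s') δ)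
        (hG.mono inter_subset_left) (hG'.mono inter_subset_right)
        (Metric.isOpen_ball.inter Metric.isOpen_ball)
        ((convex_ball _ _).inter (convex_ball _ _)).isPreconnected (z₀ := f s')
        ⟨Metric.mem_ball.mpr ((hfD s' hr).trans (half_lt_self hδ)), Metric.mem_ball_self hδ⟩
        (fun w => (hG'0 w).symm) w
        ⟨hgD s' hr, Metric.mem_ball.mpr ((hclose s' hs').trans (half_lt_self hδ))⟩
  obtain ⟨G, -, hG⟩ := key (n + 1) le_rfl
  have e : ((n + 1 : ℕ) : ℝ) / (n + 1) = 1 := by push_cast; exact div_self hn0.ne'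
  rw [e] at hG
  rw [(hG w).1, (hG w).2, h1]

/-- The distance of a path to the punctures is bounded below. -/
theorem exists_ball_subset {K : Type*} [TopologicalSpace K] [CompactSpace K] (F : C(K, U)) :
    ∃ δ > 0, ∀ s, ∀ z ∈ Metric.ball (F s : ℂ) δ, z ≠ 0 ∧ z ≠ 1 := by
  have hK : IsCompact (range fun s => (F s : ℂ)) :=
    isCompact_range (continuous_subtype_val.comp F.continuous)
  have hU : IsOpen {z : ℂ | z ≠ 0 ∧ z ≠ 1} := isOpen_ne.inter isOpen_ne
  obtain ⟨δ, hδ, h⟩ := hK.exists_thickening_subset_open hU (by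
    rintro _ ⟨s, rfl⟩
    exact (F s).2)
  exact ⟨δ, hδ, fun s z hz => h (Metric.mem_thickening_iff.mpr ⟨_, ⟨s, rfl⟩, hz⟩)⟩

/-- Every path is uniformly approximated by smooth paths with the same end points. -/
theorem exists_smooth_close (p : C(unitInterval, ℂ)) {ε : ℝ} (hε : 0 < ε) :
    ∃ r : ℝ → ℂ, ContDiff ℝ ∞ r ∧ r 0 = p 0 ∧ r 1 = p 1 ∧
      ∀ t : unitInterval, dist (r t) (p t) < ε := by
  -- Bernstein polynomials converge uniformly, keep the end values for nonzero degree, and are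
  -- smooth on all of `ℝ`.
  have h1 := (bernsteinApproximation_uniform p).eventually (Metric.ball_mem_nhds _ hε)
  obtain ⟨n, hn, hn0⟩ := (h1.and (eventually_ne_atTop 0)).exists
  refine ⟨fun t => ∑ k : Fin (n + 1), ((n.choose k : ℝ) * t ^ (k : ℕ) * (1 - t) ^ (n - k)) •
    p (bernstein.z k), by fun_prop, ?_, ?_, fun t => ?_⟩
  · rw [← bernsteinApproximation.apply_zero n p, bernsteinApproximation.apply]
    simp [bernstein_apply]
  · rw [← bernsteinApproximation.apply_one hn0 p, bernsteinApproximation.apply]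
    simp [bernstein_apply]
  · have h2 := (ContinuousMap.dist_lt_iff hε).mp (Metric.mem_ball.mp hn) t
    rw [bernsteinApproximation.apply] at h2
    simpa [bernstein_apply] using h2

theorem pathFun_of_mem {x y : U} (p : Path x y) {t : ℝ} (ht : t ∈ Icc (0 : ℝ) 1) :
    pathFun p t = p ⟨t, ht⟩ := by
  rw [pathFun, Path.extend_apply _ ht]

/-- Every path is homotopic to a piecewise smooth path that is uniformly close to it. -/
theorem exists_piecewiseSmooth_close {x y : U} (p : Path x y) {ε : ℝ} (hε : 0 < ε) :
    ∃ q : Path x y, PiecewiseSmooth q ∧ q.Homotopic p ∧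
      ∀ t : unitInterval, dist (q t : ℂ) (p t : ℂ) < ε := by
  obtain ⟨δ, hδ, hball⟩ := exists_ball_subset p.toContinuousMap
  obtain ⟨r, hr, hr0, hr1, hclose⟩ := exists_smooth_close
    ⟨fun t => (p t : ℂ), by fun_prop⟩ (lt_min hδ hε)
  have hmem : ∀ t, r t ∈ Metric.ball (p t : ℂ) δ := fun t => (hclose t).trans_le (min_le_left _ _)
  let q : Path x y :=
    { toFun := fun t => ⟨r t, hball t _ (hmem t)⟩
      continuous_toFun := (hr.continuous.comp continuous_subtype_val).subtype_mk _
      source' := Subtype.ext (by simpa using hr0)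
      target' := Subtype.ext (by simpa using hr1) }
  -- The straight-line homotopy stays in the ball around `p t`, which avoids both punctures.
  have hconv : ∀ (s t : unitInterval),
      (1 - (s : ℝ)) • r t + (s : ℝ) • (p t : ℂ) ∈ Metric.ball (p t : ℂ) δ := fun s t =>
    convex_ball _ _ (hmem t) (Metric.mem_ball_self hδ) (sub_nonneg.mpr s.2.2) s.2.1 (by ring)
  refine ⟨q, ⟨1, fun i => i, Nat.mono_cast, by simp, by simp, fun i hi => ?_⟩, ⟨?_⟩, fun t =>
    (hclose t).trans_le (min_le_right _ _)⟩
  · obtain rfl : i = 0 := by omega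
    refine hr.contDiffOn.congr fun t ht => ?_
    exact pathFun_of_mem q (by simpa using ht)
  · exact
    { toFun := fun z => ⟨_, hball z.2 _ (hconv z.1 z.2)⟩
      continuous_toFun := by
        have := hr.continuous
        exact Continuous.subtype_mk (by fun_prop) _
      map_zero_left := fun t => Subtype.ext (by simp [q])
      map_one_left := fun t => Subtype.ext (by simp)
      prop' := fun s t ht => by
        rcases ht with rfl | ht
        · refine Subtype.ext ?_
          have : r 0 = x := by simpa using hr0
          simp [q, this]
          ring
        · rw [mem_singleton_iff] at ht
          subst ht
          refine Subtype.ext ?_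
          have : r 1 = y := by simpa using hr1
          simp [q, this]
          ring }

/-- Homotopy invariance of iterated integrals. -/
theorem iterIntegral_eq_of_homotopic {x y : U} {p q : Path x y} {S T : Set ℝ}
    (hp : RegularPath (pathFun p) S) (hq : RegularPath (pathFun q) T) (h : p.Homotopic q)
    (w : List Form) : iterIntegral (pathFun p) w 1 = iterIntegral (pathFun q) w 1 := by
  obtain ⟨F⟩ := h
  obtain ⟨δ, hδ, hball⟩ := exists_ball_subset F.toContinuousMap
  have hδ' : 0 < δ / 16 := by positivity
  -- The intermediate paths of the homotopy are only continuous, so smooth approximations stand in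
  -- for them.
  choose r hr _ hclose using fun s => exists_piecewiseSmooth_close (F.eval s) hδ'
  choose R hR using fun s => (hr s).regularPath
  -- The radii fit: `δ / 2 + δ / 16 < δ` keeps the balls around `p` off the punctures, and `δ / 16 +
  -- δ / 8 < δ / 4` is the closeness required for radius `δ / 2`.
  have close : ∀ {p q : Path x y} {S T : Set ℝ}, RegularPath (pathFun p) S →
      RegularPath (pathFun q) T → ∀ s, (∀ t, dist (p t : ℂ) (F (s, t)) < δ / 16) →
      (∀ t, dist (q t : ℂ) (F (s, t)) < δ / 8) →
      iterIntegral (pathFun p) w 1 = iterIntegral (pathFun q) w 1 := by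
    intro p q S T hp hq s h1 h2
    refine iterIntegral_eq_of_close hp hq (half_pos hδ) (fun t ht z hz => ?_) (fun t ht => ?_)
      (by rw [pathFun_zero, pathFun_zero]) (by rw [pathFun_one, pathFun_one]) w
    · rw [pathFun_of_mem p ht, Metric.mem_ball] at hz
      refine hball (s, ⟨t, ht⟩) z ?_
      have := dist_triangle z (p ⟨t, ht⟩ : ℂ) (F (s, ⟨t, ht⟩))
      rw [Metric.mem_ball]
      change dist z (F (s, ⟨t, ht⟩) : ℂ) < δ
      linarith [h1 ⟨t, ht⟩]
    · rw [pathFun_of_mem p ht, pathFun_of_mem q ht]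
      have := dist_triangle_right (q ⟨t, ht⟩ : ℂ) (p ⟨t, ht⟩ : ℂ) (F (s, ⟨t, ht⟩))
      linarith [h1 ⟨t, ht⟩, h2 ⟨t, ht⟩]
  have hlt : δ / 16 < δ / 8 := by linarith
  have hloc : IsLocallyConstant fun s => iterIntegral (pathFun (r s)) w 1 := by
    rw [IsLocallyConstant.iff_eventually_eq]
    intro s₀
    let Fc : C(unitInterval × unitInterval, ℂ) := ⟨fun z => (F z : ℂ), by fun_prop⟩
    have h1 := Fc.curry.continuous.continuousAt.eventually (Metric.ball_mem_nhds (Fc.curry s₀) hδ')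
    filter_upwards [h1] with s hs
    refine (close (hR s₀) (hR s) s₀ (hclose s₀) fun t => ?_).symm
    have h2 := (ContinuousMap.dist_lt_iff hδ').mp (Metric.mem_ball.mp hs) t
    change dist (F (s, t) : ℂ) (F (s₀, t)) < δ / 16 at h2
    have h3 : dist (r s t : ℂ) (F (s, t)) < δ / 16 := hclose s t
    have := dist_triangle (r s t : ℂ) (F (s, t)) (F (s₀, t))
    linarith
  have h01 := hloc.apply_eq_of_preconnectedSpace 0 1
  rw [close hp (hR 0) 0 (fun t => by simpa using hδ') fun t => (hclose 0 t).trans hlt,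
    close hq (hR 1) 1 (fun t => by simpa using hδ') fun t => (hclose 1 t).trans hlt]
  exact h01

/-! ### Iterated integrals along homotopy classes -/

theorem exists_piecewiseSmooth {x y : U} (c : Path.Homotopic.Quotient x y) :
    ∃ p : Path x y, PiecewiseSmooth p ∧ Path.Homotopic.Quotient.mk p = c := by
  obtain ⟨p, rfl⟩ := Path.Homotopic.Quotient.mk_surjective c
  obtain ⟨q, hq, hqp, -⟩ := exists_piecewiseSmooth_close p one_pos
  exact ⟨q, hq, Path.Homotopic.Quotient.eq.mpr hqp⟩

/-- The iterated integrals along a homotopy class. -/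
noncomputable def classIntegral {x y : U} (c : Path.Homotopic.Quotient x y) (w : List Form) : ℂ :=
  iterIntegral (pathFun (exists_piecewiseSmooth c).choose) w 1

/-- Any regular representative is allowed. Concatenated and reflected paths can thus be used without
showing that they are piecewise smooth. -/
theorem classIntegral_mk {x y : U} {p : Path x y} {S : Set ℝ} (hp : RegularPath (pathFun p) S)
    (w : List Form) :
    classIntegral (Path.Homotopic.Quotient.mk p) w = iterIntegral (pathFun p) w 1 := by
  have h := (exists_piecewiseSmooth (Path.Homotopic.Quotient.mk p)).choose_spec
  exact iterIntegral_eq_of_homotopic h.1.regularPath.choose_spec hp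
    (Path.Homotopic.Quotient.eq.mp h.2) w

theorem isIterIntegral_classIntegral {x y : U} (c : Path.Homotopic.Quotient x y)
    (w : List Form) : IsIterIntegral c w (classIntegral c w) := by
  refine ⟨exists_piecewiseSmooth c, ?_⟩
  rintro p hp rfl
  obtain ⟨S, hS⟩ := hp.regularPath
  exact (classIntegral_mk hS w).symm

theorem IsIterIntegral.eq_classIntegral {x y : U} {c : Path.Homotopic.Quotient x y}
    {w : List Form} {I : ℂ} (h : IsIterIntegral c w I) : I = classIntegral c w := by
  obtain ⟨⟨p, hp, hc⟩, h2⟩ := h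
  rw [← h2 p hp hc, (isIterIntegral_classIntegral c w).2 p hp hc]

theorem classIntegral_nil {x y : U} (c : Path.Homotopic.Quotient x y) : classIntegral c [] = 1 :=
  rfl

theorem classIntegral_cast {x y x' y' : U} (c : Path.Homotopic.Quotient x y) (hx : x' = x)
    (hy : y' = y) : classIntegral (c.cast hx hy) = classIntegral c := by
  subst hx hy
  simp

theorem classIntegral_refl (x : U) :
    classIntegral (Path.Homotopic.Quotient.refl x) = unitSeries := by
  funext w
  have h : RegularPath (pathFun (Path.refl x)) ∅ :=
    (RegularPath.of_hasDerivAt (g := fun _ => (x : ℂ)) (g' := fun _ => 0) (continuous_pathFun _)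
      (pathFun_mem _) (fun _ _ => rfl) (fun _ _ => hasDerivAt_const _ _)
      continuousOn_const).1
  rw [← Path.Homotopic.Quotient.mk_refl, classIntegral_mk h]
  have h0 : deriv (pathFun (Path.refl x)) = 0 := by
    have : pathFun (Path.refl x) = fun _ => (x : ℂ) := rfl
    rw [this]
    exact deriv_const' _
  cases w with
  | nil => rfl
  | cons a w => simp [iterIntegral, unitSeries, h0]

theorem hasDerivAt_affine_comp {f : ℝ → ℂ} {f' : ℂ} {c e t : ℝ}
    (h : HasDerivAt f f' (c * t + e)) : HasDerivAt (fun t => f (c * t + e)) (c * f') t := by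
  have h1 : HasDerivAt (fun t => c * t + e) c t := by
    simpa using ((hasDerivAt_id t).const_mul c).add_const e
  exact (h.scomp t h1).congr_deriv (by rw [Complex.real_smul])

theorem deriv_affine_comp (f : ℝ → ℂ) (e t : ℝ) :
    deriv (fun t => f (2 * t + e)) t = (2 : ℝ) * deriv f (2 * t + e) := by
  rw [deriv_comp_mul_left (2 : ℝ) (fun u => f (u + e)) t, deriv_comp_add_const,
    Complex.real_smul]

theorem RegularPath.affine_comp {f h : ℝ → ℂ} {S : Set ℝ} (hf : RegularPath f S) {a b e : ℝ}
    (ha : 2 * a + e = 0) (hb : 2 * b + e = 1) (hh : ∀ t ∈ Ioo a b, h t = f (2 * t + e)) :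
    (∀ t ∈ Ioo a b, deriv h t = (2 : ℝ) * deriv f (2 * t + e)) ∧
    (∀ t ∈ Ioo a b, 2 * t + e ∉ S → DifferentiableAt ℝ h t ∧ ContinuousAt (deriv h) t) ∧
    IntervalIntegrable (deriv h) MeasureTheory.volume a b := by
  have hab : a < b := by linarith
  have hev : ∀ t ∈ Ioo a b, h =ᶠ[𝓝 t] fun t => f (2 * t + e) := fun t ht => by
    filter_upwards [isOpen_Ioo.mem_nhds ht] with u hu using hh u hu
  have hd : ∀ t ∈ Ioo a b, deriv h t = (2 : ℝ) * deriv f (2 * t + e) := fun t ht => by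
    rw [(hev t ht).deriv_eq, deriv_affine_comp]
  have hmem : ∀ t ∈ Ioo a b, 2 * t + e ∈ Ioo (0 : ℝ) 1 := fun t ht =>
    ⟨by linarith [ht.1], by linarith [ht.2]⟩
  refine ⟨hd, fun t ht hS => ⟨?_, ?_⟩, ?_⟩
  · exact (hasDerivAt_affine_comp (hf.diff _ ⟨hmem t ht, hS⟩).hasDerivAt).differentiableAt
      |>.congr_of_eventuallyEq (hev t ht)
  · have h1 : ContinuousAt (fun t => ((2 : ℝ) : ℂ) * deriv f (2 * t + e)) t :=
      continuousAt_const.mul ((hf.derivCont _ ⟨hmem t ht, hS⟩).comp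
        (f := fun t : ℝ => 2 * t + e) (by fun_prop))
    refine h1.congr ?_
    filter_upwards [isOpen_Ioo.mem_nhds ht] with u hu using (hd u hu).symm
  · have h1 := ((hf.int.comp_add_right e).comp_mul_left (c := 2)).const_mul ((2 : ℝ) : ℂ)
    rw [show (0 - e) / 2 = a by linarith, show (1 - e) / 2 = b by linarith] at h1
    refine h1.congr_uIoo fun t ht => ?_
    replace ht : t ∈ Ioo a b := by rwa [uIoo_of_lt hab] at ht
    exact (hd t ht).symm

/-- The composition of paths formula for iterated integrals. -/
theorem classIntegral_trans {x y z : U} (c : Path.Homotopic.Quotient x y)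
    (d : Path.Homotopic.Quotient y z) (w : List Form) :
    classIntegral (c.trans d) w = conv (classIntegral d) (classIntegral c) w := by
  obtain ⟨p, hp, rfl⟩ := exists_piecewiseSmooth c
  obtain ⟨q, hq, rfl⟩ := exists_piecewiseSmooth d
  obtain ⟨S, hS⟩ := hp.regularPath
  obtain ⟨T, hT⟩ := hq.regularPath
  set h := pathFun (p.trans q) with hh
  have hl : ∀ t ≤ 1 / 2, h t = pathFun p (2 * t + 0) := fun t ht => by
    rw [hh, pathFun, Path.extend_trans_of_le_half _ _ ht, pathFun, add_zero]
  have hr : ∀ t, 1 / 2 ≤ t → h t = pathFun q (2 * t + -1) := fun t ht => by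
    rw [hh, pathFun, Path.extend_trans_of_half_le _ _ ht, pathFun, sub_eq_add_neg]
  obtain ⟨l1, l2, l3⟩ := hS.affine_comp (h := h) (a := 0) (b := 1 / 2) (e := 0) (by norm_num)
    (by norm_num) fun t ht => hl t ht.2.le
  obtain ⟨r1, r2, r3⟩ := hT.affine_comp (h := h) (a := 1 / 2) (b := 1) (e := -1) (by norm_num)
    (by norm_num) fun t ht => hr t ht.1.le
  set Q : Set ℝ := {1 / 2} ∪ ((fun t : ℝ => 2 * t + 0) ⁻¹' S ∪ (fun t : ℝ => 2 * t + -1) ⁻¹' T)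
    with hQ
  have hinj : ∀ e : ℝ, Function.Injective fun t : ℝ => 2 * t + e := fun e s t hst => by
    simp only at hst
    linarith
  have hQc : Q.Countable := (countable_singleton _).union
    ((hS.countable.preimage (hinj 0)).union (hT.countable.preimage (hinj (-1))))
  have hreg : RegularPath h Q := by
    have hboth : ∀ t ∈ Ioo (0 : ℝ) 1 \ Q, DifferentiableAt ℝ h t ∧ ContinuousAt (deriv h) t := by
      intro t ht
      rcases lt_trichotomy t (1 / 2) with h1 | h1 | h1
      · exact l2 t ⟨ht.1.1, h1⟩ fun h2 => ht.2 (Or.inr (Or.inl h2))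
      · exact absurd (Or.inl h1) ht.2
      · exact r2 t ⟨h1, ht.1.2⟩ fun h2 => ht.2 (Or.inr (Or.inr h2))
    exact ⟨continuous_pathFun _, hQc, fun t ht => (hboth t ht).1, fun t ht => (hboth t ht).2,
      l3.trans r3, pathFun_mem _⟩
  rw [← Path.Homotopic.Quotient.mk_trans, classIntegral_mk hreg]
  have e1 : ∀ w, iterIntegral h w (1 / 2) = classIntegral (Path.Homotopic.Quotient.mk p) w := by
    intro w
    have hf := (hS.isFlat.comp_affine two_pos 0 (a' := 0) (b' := 1 / 2) (by norm_num)
      (by norm_num)).mono (T := Q) (fun t ht => Or.inr (Or.inl ht)) le_rfl le_rfl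
    have := (hreg.isFlat.mono subset_rfl le_rfl (by norm_num : (1 / 2 : ℝ) ≤ 1)).unique hQc
      (hf.congr_coeff fun x t ht => by
        rw [pullCoeff, pullCoeff, l1 t ht.1, hl t ht.1.2.le]
        push_cast
        ring)
      (fun w => by simp [iterIntegral_zero]) w (right_mem_Icc.mpr (by norm_num))
    rw [this, classIntegral_mk hS]
    norm_num
  -- On the second half, the integrals along `q` times the constant series of `p` solve the system.
  -- At the midpoint the first factor is the unit series, so the initial values match.
  have hf := ((hT.isFlat.conv (d := classIntegral (Path.Homotopic.Quotient.mk p)) rfl).comp_affine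
    two_pos (-1) (a' := 1 / 2) (b' := 1) (by norm_num)
    (by norm_num)).mono (T := Q) (fun t ht => Or.inr (Or.inr ht)) le_rfl le_rfl
  have := (hreg.isFlat.mono subset_rfl (by norm_num : (0 : ℝ) ≤ 1 / 2) le_rfl).unique hQc
    (hf.congr_coeff fun x t ht => by
      rw [pullCoeff, pullCoeff, r1 t ht.1, hr t ht.1.1.le]
      push_cast
      ring)
    (fun w => by
      rw [e1, show (2 : ℝ) * (1 / 2) + -1 = 0 by norm_num]
      simp only [iterIntegral_zero]
      exact (unit_conv _ w).symm) w (right_mem_Icc.mpr (by norm_num))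
  rw [this, show (2 : ℝ) * 1 + -1 = 1 by norm_num]
  congr 1
  funext v
  exact (classIntegral_mk hT v).symm

/-- A solution of the system of differential equations on an arc is transported by the iterated
integrals along the pieces of the arc. -/
theorem conv_classIntegral_seg {r : ℝ} (g : C(Ioo (0 : ℝ) r, U)) {G G' : ℝ → ℂ}
    (hgG : ∀ τ : Ioo (0 : ℝ) r, (g τ : ℂ) = G τ) (hG : ∀ τ ∈ Ioo (0 : ℝ) r, HasDerivAt G (G' τ) τ)
    (hG' : ContinuousOn G' (Ioo 0 r)) {H : List Form → ℝ → ℂ}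
    (hnil : ∀ τ ∈ Ioo (0 : ℝ) r, H [] τ = 1)
    (hH : ∀ x w, ∀ τ ∈ Ioo (0 : ℝ) r, HasDerivAt (H (x :: w)) (x.coeff (G τ) * G' τ * H w τ) τ)
    (s t : Ioo (0 : ℝ) r) (w : List Form) :
    conv (classIntegral ((Path.Homotopic.Quotient.mk (seg s t)).map g)) (fun w => H w s) w =
      H w t := by
  -- The segment may run backwards or be constant: no sign of `c` is assumed.
  set c : ℝ := (t : ℝ) - s with hc
  have hmem : ∀ u ∈ Icc (0 : ℝ) 1, c * u + s ∈ Ioo (0 : ℝ) r := fun u hu => by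
    have := (seg s t ⟨u, hu⟩).2
    change (1 - u) * s.1 + u * t.1 ∈ _ at this
    rwa [show (1 - u) * s.1 + u * t.1 = c * u + s by rw [hc]; ring] at this
  set f := pathFun ((seg s t).map g.continuous) with hf
  have hfG : ∀ u ∈ Icc (0 : ℝ) 1, f u = G (c * u + s) := fun u hu => by
    rw [hf, pathFun_of_mem _ hu]
    refine (hgG _).trans ?_
    change G ((1 - u) * s.1 + u * t.1) = _
    congr 1
    rw [hc]
    ring
  obtain ⟨hreg, hder⟩ := RegularPath.of_hasDerivAt (f := f) (g := fun u => G (c * u + s))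
    (g' := fun u => c * G' (c * u + s)) (continuous_pathFun _) (pathFun_mem _) hfG
    (fun u hu => hasDerivAt_affine_comp (hG _ (hmem u hu)))
    (continuousOn_const.mul (hG'.comp (by fun_prop) hmem))
  have hHflat : IsFlat (pullCoeff f) ∅ 0 1 fun w u => H w (c * u + s) := by
    refine ⟨fun u hu => hnil _ (hmem u hu), fun w u hu => ?_, fun x w u hu => ?_⟩
    · refine ContinuousAt.continuousWithinAt ?_
      refine ContinuousAt.comp (f := fun u => c * u + s) ?_ (by fun_prop)
      cases w with
      | nil =>
        refine continuousAt_const.congr (f := fun _ => 1) ?_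
        filter_upwards [isOpen_Ioo.mem_nhds (hmem u hu)] with τ hτ using (hnil τ hτ).symm
      | cons x w => exact (hH x w _ (hmem u hu)).continuousAt
    · have hu' := Ioo_subset_Icc_self hu.1
      refine (hasDerivAt_affine_comp (hH x w _ (hmem u hu'))).congr_deriv ?_
      rw [pullCoeff, hder u hu.1, hfG u hu']
      ring
  have h1 := (hreg.isFlat.conv (d := fun w => H w s) (hnil s s.2)).unique countable_empty hHflat
    (fun w => by
      simp only [iterIntegral_zero, mul_zero, zero_add]
      exact unit_conv _ w) w (right_mem_Icc.mpr zero_le_one)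
  have h2 : classIntegral ((Path.Homotopic.Quotient.mk (seg s t)).map g) =
      fun v => iterIntegral f v 1 := funext fun v => by
    rw [← Path.Homotopic.Quotient.mk_map, classIntegral_mk hreg]
  rw [h2, h1, mul_one, hc, sub_add_cancel]

/-- Along a class and its image under `φ`, the relations between words in one letter persist and
the duality sum is constant. -/
theorem DualPair.transport {x y : U} (γ : Path.Homotopic.Quotient x y) {c d : List Form → ℂ}
    (hc : c [] = 1) (hd : d [] = 1) (h : DualPair c d) :
    DualPair (conv (classIntegral γ) c) (conv (classIntegral (γ.map phi)) d) ∧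
    ∀ M N, dualitySum (conv (classIntegral γ) c) (conv (classIntegral (γ.map phi)) d) M (N + 1) =
      dualitySum c d M (N + 1) := by
  obtain ⟨p, hp, rfl⟩ := exists_piecewiseSmooth γ
  obtain ⟨S, hS⟩ := hp.regularPath
  set f := pathFun p with hf
  set g := pathFun (p.map phi.continuous) with hg
  have hgf : g = fun t => 1 - f t := rfl
  have hgd : deriv g = fun t => -deriv f t := funext fun t => by rw [hgf, deriv_const_sub]
  have hreg : RegularPath g S := by
    refine ⟨continuous_pathFun _, hS.countable, fun t ht => ?_, fun t ht => ?_, ?_, pathFun_mem _⟩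
    · exact (hS.diff t ht).const_sub 1
    · rw [hgd]
      exact (hS.derivCont t ht).neg
    · rw [hgd]
      exact hS.int.neg
  -- With `t` replaced by `1 - t`, `dt / t` becomes `-dt / (1 - t)`.
  have hX : ∀ t ∈ Ioo (0 : ℝ) 1 \ S, pullCoeff g .X t = -pullCoeff f .Y t := fun t _ => by
    rw [pullCoeff, pullCoeff, hgd, hgf]
    simp only [Form.coeff]
    ring
  have hY : ∀ t ∈ Ioo (0 : ℝ) 1 \ S, pullCoeff g .Y t = -pullCoeff f .X t := fun t _ => by
    rw [pullCoeff, pullCoeff, hgd, hgf]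
    simp only [Form.coeff, sub_sub_cancel]
    ring
  have e0 : ∀ (k : ℝ → ℂ) (e : List Form → ℂ),
      conv (fun v => iterIntegral k v 0) e = e := fun k e => funext fun w => by
    simp only [iterIntegral_zero]
    exact unit_conv e w
  have e1 : ∀ {k : ℝ → ℂ} {z z' : U} {q : Path z z'}, RegularPath (pathFun q) S →
      k = pathFun q → classIntegral (Path.Homotopic.Quotient.mk q) = fun v => iterIntegral k v 1 :=
    fun hq hk => funext fun v => by rw [classIntegral_mk hq, hk]
  rw [← Path.Homotopic.Quotient.mk_map, e1 hS hf, e1 hreg hg]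
  have F1 := hS.isFlat.conv hc
  have F2 := hreg.isFlat.conv hd
  have h0 : DualPair (fun w => conv (fun v => iterIntegral f v 0) c w)
      fun w => conv (fun v => iterIntegral g v 0) d w := by
    rwa [e0, e0]
  have hr : (1 : ℝ) ∈ Icc (0 : ℝ) 1 := right_mem_Icc.mpr zero_le_one
  refine ⟨F1.dualPair F2 hS.countable hX hY h0 hr, fun M N => ?_⟩
  have := F1.dualitySum_eq F2 hS.countable hX hY h0 M N hr
  rwa [e0, e0] at this

theorem classIntegral_symm_singleton {x y : U} (c : Path.Homotopic.Quotient x y) (a : Form) :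
    classIntegral c.symm [a] = -classIntegral c [a] := by
  have h := classIntegral_trans c c.symm [a]
  rw [Path.Homotopic.Quotient.trans_symm, classIntegral_refl] at h
  simp only [unitSeries, conv, classIntegral_nil, one_mul, mul_one] at h
  linear_combination -h

theorem classIntegral_trans_singleton {x y z : U} (c : Path.Homotopic.Quotient x y)
    (d : Path.Homotopic.Quotient y z) (a : Form) :
    classIntegral (c.trans d) [a] = classIntegral c [a] + classIntegral d [a] := by
  rw [classIntegral_trans]
  simp [conv, classIntegral_nil]

open Asymptotics

/-! ### Logarithmic expansions -/

/-- `f(ε)` is a polynomial in `log ε` up to a positive power of `ε`. -/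
def HasLogExp (f : ℝ → ℂ) (P : Polynomial ℂ) : Prop :=
  ∃ c : ℝ, 0 < c ∧
    (fun ε : ℝ => f ε - P.eval ((Real.log ε : ℝ) : ℂ)) =O[𝓝[>] (0 : ℝ)] fun ε : ℝ => ε ^ c

theorem isBigO_rpow_rpow {a b : ℝ} (h : b ≤ a) :
    (fun ε : ℝ => ε ^ a) =O[𝓝[>] (0 : ℝ)] fun ε : ℝ => ε ^ b := by
  refine IsBigO.of_bound 1 ?_
  filter_upwards [Ioo_mem_nhdsGT one_pos] with ε hε
  rw [one_mul, Real.norm_of_nonneg (Real.rpow_nonneg hε.1.le _),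
    Real.norm_of_nonneg (Real.rpow_nonneg hε.1.le _)]
  exact Real.rpow_le_rpow_of_exponent_ge hε.1 hε.2.le h

theorem isBigO_mul_rpow {f g : ℝ → ℂ} {a b c : ℝ} (hf : f =O[𝓝[>] (0 : ℝ)] fun ε : ℝ => ε ^ a)
    (hg : g =O[𝓝[>] (0 : ℝ)] fun ε : ℝ => ε ^ b) (h : c ≤ a + b) :
    (fun ε => f ε * g ε) =O[𝓝[>] (0 : ℝ)] fun ε : ℝ => ε ^ c := by
  refine ((hf.mul hg).congr' EventuallyEq.rfl ?_).trans (isBigO_rpow_rpow h)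
  filter_upwards [self_mem_nhdsWithin] with ε hε
  exact (Real.rpow_add hε a b).symm

theorem isBigO_log_pow (n : ℕ) {c : ℝ} (hc : 0 < c) :
    (fun ε : ℝ => ((Real.log ε : ℝ) : ℂ) ^ n) =O[𝓝[>] (0 : ℝ)] fun ε : ℝ => ε ^ (-c) := by
  have h := (isLittleO_abs_log_rpow_rpow_nhdsGT_zero (n : ℝ) (neg_lt_zero.mpr hc)).isBigO
  refine (IsBigO.of_norm_right (IsBigO.of_bound 1 (Eventually.of_forall fun ε => ?_))).trans h
  simp

theorem isBigO_eval_log (P : Polynomial ℂ) {c : ℝ} (hc : 0 < c) :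
    (fun ε : ℝ => P.eval ((Real.log ε : ℝ) : ℂ)) =O[𝓝[>] (0 : ℝ)] fun ε : ℝ => ε ^ (-c) := by
  induction P using Polynomial.induction_on' with
  | add p q hp hq => simpa using hp.add hq
  | monomial n a => simpa using (isBigO_log_pow n hc).const_mul_left a

namespace HasLogExp

variable {f g : ℝ → ℂ} {P Q : Polynomial ℂ}

theorem of_isBigO {c : ℝ} (hc : 0 < c) (h : f =O[𝓝[>] (0 : ℝ)] fun ε : ℝ => ε ^ c) :
    HasLogExp f 0 := ⟨c, hc, by simpa using h⟩

theorem eval (P : Polynomial ℂ) : HasLogExp (fun ε => P.eval ((Real.log ε : ℝ) : ℂ)) P :=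
  ⟨1, one_pos, by simpa using isBigO_zero _ _⟩

theorem const (a : ℂ) : HasLogExp (fun _ => a) (Polynomial.C a) := by
  simpa using eval (Polynomial.C a)

theorem congr' (h : HasLogExp f P) (hfg : ∀ᶠ ε in 𝓝[>] (0 : ℝ), f ε = g ε) : HasLogExp g P := by
  obtain ⟨c, hc, h⟩ := h
  refine ⟨c, hc, h.congr' ?_ EventuallyEq.rfl⟩
  filter_upwards [hfg] with ε hε
  rw [hε]

theorem add (hf : HasLogExp f P) (hg : HasLogExp g Q) :
    HasLogExp (fun ε => f ε + g ε) (P + Q) := by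
  obtain ⟨a, ha, hf⟩ := hf
  obtain ⟨b, hb, hg⟩ := hg
  refine ⟨min a b, lt_min ha hb, ?_⟩
  refine ((hf.trans (isBigO_rpow_rpow (min_le_left a b))).add
    (hg.trans (isBigO_rpow_rpow (min_le_right a b)))).congr_left fun ε => ?_
  rw [Polynomial.eval_add]
  ring

/-- A polynomial in `log ε` costs an arbitrarily small power of `ε`; half of each error exponent
pays for it. A mere `o(1)` error would not survive multiplication. -/
theorem mul (hf : HasLogExp f P) (hg : HasLogExp g Q) :
    HasLogExp (fun ε => f ε * g ε) (P * Q) := by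
  obtain ⟨a, ha, hf⟩ := hf
  obtain ⟨b, hb, hg⟩ := hg
  have ha2 : 0 < a / 2 := by linarith
  have hb2 : 0 < b / 2 := by linarith
  refine ⟨min (a / 2) (b / 2), lt_min ha2 hb2, ?_⟩
  have h1 := isBigO_mul_rpow (c := min (a / 2) (b / 2)) hf hg
    (by linarith [min_le_left (a / 2) (b / 2)])
  have h2 := isBigO_mul_rpow (c := min (a / 2) (b / 2)) (isBigO_eval_log P hb2) hg
    (by linarith [min_le_right (a / 2) (b / 2)])
  have h3 := isBigO_mul_rpow (c := min (a / 2) (b / 2)) hf (isBigO_eval_log Q ha2)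
    (by linarith [min_le_left (a / 2) (b / 2)])
  refine ((h1.add h2).add h3).congr_left fun ε => ?_
  rw [Polynomial.eval_mul]
  ring

theorem const_mul (a : ℂ) (hf : HasLogExp f P) :
    HasLogExp (fun ε => a * f ε) (Polynomial.C a * P) := (const a).mul hf

theorem neg (hf : HasLogExp f P) : HasLogExp (fun ε => -f ε) (-P) := by
  simpa using hf.const_mul (-1)

theorem sub (hf : HasLogExp f P) (hg : HasLogExp g Q) :
    HasLogExp (fun ε => f ε - g ε) (P - Q) := by
  simpa [sub_eq_add_neg] using hf.add hg.neg

theorem pow (hf : HasLogExp f P) (n : ℕ) : HasLogExp (fun ε => f ε ^ n) (P ^ n) := by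
  induction n with
  | zero => simpa using const 1
  | succ n ih => simpa [pow_succ] using ih.mul hf

theorem sum {ι : Type*} (s : Finset ι) {f : ι → ℝ → ℂ} {P : ι → Polynomial ℂ}
    (h : ∀ i ∈ s, HasLogExp (f i) (P i)) :
    HasLogExp (fun ε => ∑ i ∈ s, f i ε) (∑ i ∈ s, P i) := by
  classical
  induction s using Finset.induction_on with
  | empty => simpa using const 0
  | insert i s hi ih =>
    simp only [Finset.sum_insert hi]
    exact (h i (Finset.mem_insert_self _ _)).add
      (ih fun j hj => h j (Finset.mem_insert_of_mem hj))

theorem hasRegValue (h : HasLogExp f P) : HasRegValue f (P.coeff 0) := by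
  obtain ⟨c, hc, h⟩ := h
  refine ⟨P, rfl, h.trans_tendsto ?_⟩
  have := (Real.continuousAt_rpow_const 0 c (Or.inr hc.le)).tendsto
  rw [Real.zero_rpow hc.ne'] at this
  exact this.mono_left nhdsWithin_le_nhds

end HasLogExp

/-- A nonconstant polynomial is unbounded as `log ε → -∞`. This makes regularised values unique. -/
theorem eq_zero_of_tendsto_eval_log {P : Polynomial ℂ}
    (h : Tendsto (fun ε : ℝ => P.eval ((Real.log ε : ℝ) : ℂ)) (𝓝[>] (0 : ℝ)) (𝓝 0)) : P = 0 := by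
  by_contra hP
  rcases Nat.eq_zero_or_pos P.natDegree with h0 | h0
  · rw [Polynomial.eq_C_of_natDegree_eq_zero h0] at h hP
    simp only [Polynomial.eval_C] at h
    exact hP (by rw [tendsto_nhds_unique tendsto_const_nhds h, map_zero])
  · have h1 : Tendsto (fun ε : ℝ => ‖((Real.log ε : ℝ) : ℂ)‖) (𝓝[>] (0 : ℝ)) atTop := by
      simp only [Complex.norm_real, Real.norm_eq_abs]
      exact tendsto_abs_atBot_atTop.comp Real.tendsto_log_nhdsGT_zero
    have h2 := P.tendsto_norm_atTop (Polynomial.natDegree_pos_iff_degree_pos.mp h0) h1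
    exact not_tendsto_atTop_of_tendsto_nhds h.norm h2

theorem HasRegValue.unique {f g : ℝ → ℂ} {L L' : ℂ} (hf : HasRegValue f L)
    (hg : HasRegValue g L') (hfg : ∀ᶠ ε in 𝓝[>] (0 : ℝ), f ε = g ε) : L = L' := by
  obtain ⟨P, rfl, hP⟩ := hf
  obtain ⟨Q, rfl, hQ⟩ := hg
  have h := hQ.sub hP
  rw [sub_zero] at h
  have : P - Q = 0 := eq_zero_of_tendsto_eval_log <| h.congr' <| by
    filter_upwards [hfg] with ε hε
    rw [hε, Polynomial.eval_sub]
    ring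
  rw [sub_eq_zero.mp this]

theorem HasLogExp.coeff_zero_unique {f g : ℝ → ℂ} {P Q : Polynomial ℂ} (hf : HasLogExp f P)
    (hg : HasLogExp g Q) (hfg : ∀ᶠ ε in 𝓝[>] (0 : ℝ), f ε = g ε) : P.coeff 0 = Q.coeff 0 :=
  hf.hasRegValue.unique hg.hasRegValue hfg

/-- Since `Q(log τ)' = Q'(log τ) / τ`, integrating a simple pole against a polynomial in `log τ`
reduces to this. -/
theorem exists_derivative_eq (P : Polynomial ℂ) : ∃ Q, Polynomial.derivative Q = P := by
  induction P using Polynomial.induction_on' with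
  | add p q hp hq =>
    obtain ⟨p', rfl⟩ := hp
    obtain ⟨q', rfl⟩ := hq
    exact ⟨p' + q', by simp⟩
  | monomial n a =>
    refine ⟨Polynomial.monomial (n + 1) (a / (n + 1)), ?_⟩
    rw [Polynomial.derivative_monomial]
    have : (n : ℂ) + 1 ≠ 0 := by exact_mod_cast n.succ_ne_zero
    congr 1
    push_cast
    field_simp

/-- A function on `(0, ρ)` whose derivative is `O(τ^(c - 1))` converges at `0` up to `O(τ^c)`. -/
theorem exists_limit_of_deriv_bound {E E' : ℝ → ℂ} {ρ C c : ℝ} (hρ : 0 < ρ) (hc : 0 < c)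
    (hE : ∀ τ ∈ Ioo 0 ρ, HasDerivAt E (E' τ) τ) (hb : ∀ τ ∈ Ioo 0 ρ, ‖E' τ‖ ≤ C * τ ^ (c - 1)) :
    ∃ L, ∀ τ ∈ Ioo 0 ρ, ‖E τ - L‖ ≤ C / c * τ ^ c := by
  have hC : 0 ≤ C := by
    have h1 := hb (ρ / 2) ⟨by linarith, by linarith⟩
    have h2 : 0 < (ρ / 2) ^ (c - 1) := Real.rpow_pos_of_pos (by linarith) _
    by_contra h
    have := mul_neg_of_neg_of_pos (not_le.mp h) h2
    linarith [norm_nonneg (E' (ρ / 2))]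
  have key : ∀ x y, 0 < x → x ≤ y → y < ρ → ‖E y - E x‖ ≤ C / c * y ^ c := by
    intro x y hx hxy hy
    have hsub : ∀ t ∈ Icc x y, t ∈ Ioo 0 ρ := fun t ht => ⟨hx.trans_le ht.1, ht.2.trans_lt hy⟩
    have hB : ∀ t ∈ Icc x y,
        HasDerivAt (fun t : ℝ => C / c * (t ^ c - x ^ c)) (C * t ^ (c - 1)) t :=
      fun t ht => by
        refine (((Real.hasDerivAt_rpow_const (Or.inl (hsub t ht).1.ne')).sub_const _).const_mul
          (C / c)).congr_deriv ?_
        field_simp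
    -- The increment of `E` is compared with that of `C / c * t ^ c`, whose derivative is the given
    -- bound.
    have h1 := image_norm_le_of_norm_deriv_right_le_deriv_boundary' (f := fun t => E t - E x)
      (f' := E') (a := x) (b := y) (B := fun t : ℝ => C / c * (t ^ c - x ^ c))
      (B' := fun t => C * t ^ (c - 1))
      (fun t ht => ((hE t (hsub t ht)).continuousAt.sub continuousAt_const).continuousWithinAt)
      (fun t ht => ((hE t (hsub t (Ico_subset_Icc_self ht))).sub_const _).hasDerivWithinAt)
      (by simp) (fun t ht => (hB t ht).continuousAt.continuousWithinAt)
      (fun t ht => (hB t (Ico_subset_Icc_self ht)).hasDerivWithinAt)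
      (fun t ht => hb t (hsub t (Ico_subset_Icc_self ht))) (right_mem_Icc.mpr hxy)
    refine h1.trans (mul_le_mul_of_nonneg_left ?_ (by positivity))
    linarith [Real.rpow_nonneg hx.le c]
  have hlim : Tendsto (fun τ : ℝ => C / c * τ ^ c) (𝓝[>] 0) (𝓝 0) := by
    have := ((Real.continuousAt_rpow_const 0 c (Or.inr hc.le)).const_mul (C / c)).tendsto
    rw [Real.zero_rpow hc.ne', mul_zero] at this
    exact this.mono_left nhdsWithin_le_nhds
  have hcau : Cauchy (map E (𝓝[>] 0)) := by
    rw [Metric.cauchy_iff]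
    refine ⟨inferInstance, fun e he => ?_⟩
    obtain ⟨δ, hδ, h2⟩ := mem_nhdsGT_iff_exists_Ioo_subset.mp
      (inter_mem (hlim.eventually (gt_mem_nhds he)) (Ioo_mem_nhdsGT hρ))
    refine ⟨E '' Ioo 0 δ, image_mem_map (Ioo_mem_nhdsGT hδ), ?_⟩
    rintro _ ⟨x, hx, rfl⟩ _ ⟨y, hy, rfl⟩
    rcases le_total x y with hxy | hxy
    · rw [dist_comm, dist_eq_norm]
      exact (key x y hx.1 hxy (h2 hy).2.2).trans_lt (h2 hy).1
    · rw [dist_eq_norm]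
      exact (key y x hy.1 hxy (h2 hx).2.2).trans_lt (h2 hx).1
  obtain ⟨L, hL⟩ := cauchy_iff_exists_le_nhds.mp hcau
  refine ⟨L, fun y hy => ?_⟩
  have hL' : Tendsto (fun x => ‖E y - E x‖) (𝓝[>] 0) (𝓝 ‖E y - L‖) :=
    (tendsto_const_nhds.sub hL).norm
  refine le_of_tendsto hL' ?_
  filter_upwards [Ioo_mem_nhdsGT hy.1] with x hx using key x y hx.1 hx.2.le hy.2

/-- Logarithmic expansions can be integrated against a coefficient with a simple pole. -/
theorem HasLogExp.primitive {f F k : ℝ → ℂ} {P : Polynomial ℂ} (hf : HasLogExp f P) {ρ : ℝ}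
    (hρ : 0 < ρ) {r : ℂ}
    (hk : (fun τ : ℝ => k τ - r / τ) =O[𝓝[>] (0 : ℝ)] fun _ : ℝ => (1 : ℝ))
    (hF : ∀ τ ∈ Ioo 0 ρ, HasDerivAt F (k τ * f τ) τ) : ∃ Q, HasLogExp F Q := by
  obtain ⟨c, hc, hf⟩ := hf
  obtain ⟨Q, hQ⟩ := exists_derivative_eq (Polynomial.C r * P)
  -- The pole times the error of `f` is `O(τ^(c - 1))`; the bounded part of `k` times a polynomial
  -- in `log τ` is `O(τ^(-1/2))`.
  set e := min c (1 / 2) with he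
  have he0 : 0 < e := lt_min hc (by norm_num)
  set D' : ℝ → ℂ := fun τ => k τ * (f τ - P.eval ((Real.log τ : ℝ) : ℂ)) +
    (k τ - r / τ) * P.eval ((Real.log τ : ℝ) : ℂ) with hD'
  have hk0 : (fun τ : ℝ => k τ - r / τ) =O[𝓝[>] (0 : ℝ)] fun τ : ℝ => τ ^ (0 : ℝ) := by
    simpa using hk
  have hk1 : k =O[𝓝[>] (0 : ℝ)] fun τ : ℝ => τ ^ (-1 : ℝ) := by
    have h1 : (fun τ : ℝ => r / τ) =O[𝓝[>] (0 : ℝ)] fun τ : ℝ => τ ^ (-1 : ℝ) := by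
      refine IsBigO.of_bound ‖r‖ ?_
      filter_upwards [self_mem_nhdsWithin] with τ hτ
      rw [Real.rpow_neg_one, norm_div, norm_inv, Complex.norm_real, div_eq_mul_inv]
    simpa using (hk0.trans (isBigO_rpow_rpow (by norm_num : (-1 : ℝ) ≤ 0))).add h1
  have hD'O : D' =O[𝓝[>] (0 : ℝ)] fun τ : ℝ => τ ^ (e - 1) :=
    (isBigO_mul_rpow hk1 hf (by linarith [min_le_left c (1 / 2)])).add
      (isBigO_mul_rpow hk0 (isBigO_eval_log P (c := 1 / 2) (by norm_num))
        (by linarith [min_le_right c (1 / 2)]))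
  obtain ⟨C, hC⟩ := hD'O.bound
  obtain ⟨δ, hδ, h2⟩ := mem_nhdsGT_iff_exists_Ioo_subset.mp (inter_mem hC (Ioo_mem_nhdsGT hρ))
  obtain ⟨L, hL⟩ := exists_limit_of_deriv_bound (E := fun τ => F τ - Q.eval ((Real.log τ : ℝ) : ℂ))
    (E' := D') (C := C) hδ he0 (fun τ hτ => by
      have h3 : HasDerivAt (fun τ : ℝ => Q.eval ((Real.log τ : ℝ) : ℂ))
          (Q.derivative.eval ((Real.log τ : ℝ) : ℂ) * ((τ⁻¹ : ℝ) : ℂ)) τ :=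
        (Q.hasDerivAt _).comp τ ((Real.hasDerivAt_log hτ.1.ne').ofReal_comp)
      refine ((hF τ (h2 hτ).2).sub h3).congr_deriv ?_
      rw [hQ, hD', Polynomial.eval_mul, Polynomial.eval_C]
      push_cast
      ring) (fun τ hτ => by
      have h3 : ‖D' τ‖ ≤ C * ‖τ ^ (e - 1)‖ := (h2 hτ).1
      rwa [Real.norm_of_nonneg (Real.rpow_nonneg hτ.1.le _)] at h3)
  refine ⟨Q + Polynomial.C L, e, he0, IsBigO.of_bound (C / e) ?_⟩
  filter_upwards [Ioo_mem_nhdsGT hδ] with τ hτ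
  rw [Polynomial.eval_add, Polynomial.eval_C, ← sub_sub,
    Real.norm_of_nonneg (Real.rpow_nonneg hτ.1.le _)]
  exact hL τ hτ

/-! ### The polylogarithms on the unit interval -/

open Classical in
/-- The (regularised) multiple polylogarithms on `(0, 1)`. -/
noncomputable def ell : List Form → ℝ → ℂ
  | [], _ => 1
  | a :: w, s => if Form.Y ∈ a :: w then ∫ u in (0 : ℝ)..s, a.coeff u * ell w u
      else ((Real.log s : ℝ) : ℂ) ^ (w.length + 1) / ((w.length + 1).factorial : ℂ)

theorem ell_of_notMem {w : List Form} (h : Form.Y ∉ w) (s : ℝ) :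
    ell w s = ((Real.log s : ℝ) : ℂ) ^ w.length / (w.length.factorial : ℂ) := by
  cases w with
  | nil => simp [ell]
  | cons a w => rw [ell, if_neg h, List.length_cons]

theorem ell_X (s : ℝ) : ell [.X] s = ((Real.log s : ℝ) : ℂ) := by
  rw [ell_of_notMem (by simp)]
  simp

theorem ell_of_mem {a : Form} {w : List Form} (h : Form.Y ∈ a :: w) :
    ell (a :: w) = fun s : ℝ => ∫ u in (0 : ℝ)..s, a.coeff u * ell w u := by
  funext s
  rw [ell, if_pos h]

theorem form_coeff_mem {u : ℝ} (hu : u ∈ Ioo (0 : ℝ) 1) : (u : ℂ) ≠ 0 ∧ (u : ℂ) ≠ 1 :=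
  ⟨by exact_mod_cast hu.1.ne', by exact_mod_cast hu.2.ne⟩

theorem norm_coeff_X {u : ℝ} (hu : 0 < u) : ‖Form.X.coeff u‖ = u ^ (-1 : ℝ) := by
  rw [Form.coeff, norm_div, norm_one, Complex.norm_real, Real.norm_of_nonneg hu.le,
    Real.rpow_neg_one, one_div]

theorem norm_coeff_Y {u : ℝ} (hu : u ≤ 1 / 2) : ‖Form.Y.coeff u‖ ≤ 2 := by
  have h : (1 : ℂ) - u = ((1 - u : ℝ) : ℂ) := by push_cast; ring
  rw [Form.coeff, norm_div, norm_one, h, Complex.norm_real, Real.norm_of_nonneg (by linarith)]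
  rw [div_le_iff₀ (by linarith)]
  linarith

/-- Integrating `u^(-1/2)` gives `2 s^(1/2)`, and a further factor `1 / u` brings back the exponent
`-1/2`: the pair of exponents reproduces itself along the recursion for `ell`. -/
theorem primitive_of_bound {h : ℝ → ℂ} {C : ℝ} (hc : ContinuousOn h (Ioo 0 1))
    (hb : ∀ u ∈ Ioc (0 : ℝ) (1 / 2), ‖h u‖ ≤ C * u ^ (-(1 / 2) : ℝ)) :
    (∀ s ∈ Ioo (0 : ℝ) 1, HasDerivAt (fun s => ∫ u in (0 : ℝ)..s, h u) (h s) s) ∧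
    ∀ s ∈ Ioc (0 : ℝ) (1 / 2), ‖∫ u in (0 : ℝ)..s, h u‖ ≤ 2 * C * s ^ (1 / 2 : ℝ) := by
  have hrp : ∀ s : ℝ, IntervalIntegrable (fun u : ℝ => C * u ^ (-(1 / 2) : ℝ))
      MeasureTheory.volume 0 s := fun s =>
    (intervalIntegral.intervalIntegrable_rpow' (by norm_num)).const_mul C
  have hint : IntervalIntegrable h MeasureTheory.volume 0 (1 / 2) := by
    refine (hrp (1 / 2)).mono_fun' ?_ ?_
    · rw [uIoc_of_le (by norm_num)]
      exact (hc.mono fun u hu => ⟨hu.1, hu.2.trans_lt (by norm_num)⟩).aestronglyMeasurable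
        measurableSet_Ioc
    · rw [uIoc_of_le (by norm_num)]
      exact (MeasureTheory.ae_restrict_iff' measurableSet_Ioc).mpr (Eventually.of_forall hb)
  refine ⟨fun s hs => ?_, fun s hs => ?_⟩
  · refine intervalIntegral.integral_hasDerivAt_right ?_ ?_
      (hc.continuousAt (isOpen_Ioo.mem_nhds hs))
    · refine hint.trans (ContinuousOn.intervalIntegrable (hc.mono fun u hu => ?_))
      have h1 : (1 / 2 : ℝ) ∈ Ioo (0 : ℝ) 1 := by constructor <;> norm_num
      exact (ordConnected_Ioo.uIcc_subset h1 hs) hu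
    · exact hc.stronglyMeasurableAtFilter isOpen_Ioo s hs
  · refine (intervalIntegral.norm_integral_le_of_norm_le hs.1.le
      (Eventually.of_forall fun u hu => hb u ⟨hu.1, hu.2.trans hs.2⟩) (hrp s)).trans_eq ?_
    rw [intervalIntegral.integral_const_mul, integral_rpow (Or.inl (by norm_num))]
    norm_num
    ring

theorem exists_log_pow_le (n : ℕ) : ∃ C : ℝ, ∀ u ∈ Ioc (0 : ℝ) (1 / 2),
    ‖((Real.log u : ℝ) : ℂ) ^ n / (n.factorial : ℂ)‖ ≤ C * u ^ (-(1 / 2) : ℝ) := by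
  have h1 := (((isBigO_log_pow n (c := 1 / 2) (by norm_num)).const_mul_left
    ((n.factorial : ℂ)⁻¹)).bound)
  obtain ⟨C, hC⟩ := h1
  obtain ⟨δ, hδ, h2⟩ := mem_nhdsGT_iff_exists_Ioo_subset.mp hC
  -- The asymptotic bound holds only below `δ`; compactness of `[δ, 1]` covers the rest.
  have hcont : ContinuousOn (fun u : ℝ => ‖((Real.log u : ℝ) : ℂ) ^ n / (n.factorial : ℂ)‖ *
      u ^ (1 / 2 : ℝ)) (Icc δ 1) := by
    intro u hu
    have hu0 : u ≠ 0 := (lt_of_lt_of_le hδ hu.1).ne'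
    refine ContinuousAt.continuousWithinAt (ContinuousAt.mul ?_ ?_)
    · exact (((Complex.continuous_ofReal.continuousAt.comp
        (Real.continuousAt_log hu0)).pow n).div_const _).norm
    · exact Real.continuousAt_rpow_const _ _ (Or.inl hu0)
  obtain ⟨C', hC'⟩ := isCompact_Icc.exists_bound_of_continuousOn hcont
  refine ⟨max C C', fun u hu => ?_⟩
  have hpos : 0 < u ^ (-(1 / 2) : ℝ) := Real.rpow_pos_of_pos hu.1 _
  rcases lt_or_ge u δ with h | h
  · have h3 : ‖((n.factorial : ℂ)⁻¹) * ((Real.log u : ℝ) : ℂ) ^ n‖ ≤ C * ‖u ^ (-(1 / 2) : ℝ)‖ :=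
      h2 ⟨hu.1, h⟩
    rw [Real.norm_of_nonneg hpos.le] at h3
    rw [div_eq_inv_mul]
    exact h3.trans (mul_le_mul_of_nonneg_right (le_max_left _ _) hpos.le)
  · have h3 := hC' u ⟨h, hu.2.trans (by norm_num)⟩
    rw [norm_mul, norm_norm, Real.norm_of_nonneg (Real.rpow_nonneg hu.1.le _)] at h3
    rw [Real.rpow_neg hu.1.le, ← div_eq_mul_inv, le_div_iff₀ (Real.rpow_pos_of_pos hu.1 _)]
    exact h3.trans (le_max_right _ _)

/-- If `w` contains `Y`, its bound `s^(1/2)` absorbs the pole of `X`. If `Y` is the new letter, `w`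
is a power of the logarithm and the coefficient is bounded. With no `Y` at all `ell` is explicit. -/
theorem ell_spec (w : List Form) :
    ContinuousOn (ell w) (Ioo 0 1) ∧
    (Form.Y ∈ w → ∃ C : ℝ, ∀ s ∈ Ioc (0 : ℝ) (1 / 2), ‖ell w s‖ ≤ C * s ^ (1 / 2 : ℝ)) ∧
    ∀ a, ∀ s ∈ Ioo (0 : ℝ) 1, HasDerivAt (ell (a :: w)) (a.coeff s * ell w s) s := by
  have step : ∀ w, ContinuousOn (ell w) (Ioo 0 1) →
      (Form.Y ∈ w → ∃ C : ℝ, ∀ s ∈ Ioc (0 : ℝ) (1 / 2), ‖ell w s‖ ≤ C * s ^ (1 / 2 : ℝ)) →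
      ∀ a, (∀ s ∈ Ioo (0 : ℝ) 1, HasDerivAt (ell (a :: w)) (a.coeff s * ell w s) s) ∧
        (Form.Y ∈ a :: w → ∃ C : ℝ, ∀ s ∈ Ioc (0 : ℝ) (1 / 2),
          ‖ell (a :: w) s‖ ≤ C * s ^ (1 / 2 : ℝ)) := by
    intro w hcont hbound a
    by_cases ha : Form.Y ∈ a :: w
    · have hc : ContinuousOn (fun u : ℝ => a.coeff u * ell w u) (Ioo 0 1) := by
        refine ContinuousOn.mul (fun u hu => ?_) hcont
        exact ((a.continuousAt_coeff (form_coeff_mem hu)).comp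
          Complex.continuous_ofReal.continuousAt).continuousWithinAt
      obtain ⟨C, hC⟩ : ∃ C : ℝ, ∀ u ∈ Ioc (0 : ℝ) (1 / 2),
          ‖a.coeff u * ell w u‖ ≤ C * u ^ (-(1 / 2) : ℝ) := by
        by_cases hw : Form.Y ∈ w
        · obtain ⟨C, hC⟩ := hbound hw
          refine ⟨C, fun u hu => ?_⟩
          have hcoeff : ‖a.coeff u‖ ≤ u ^ (-1 : ℝ) := by
            cases a with
            | X => exact (norm_coeff_X hu.1).le
            | Y =>
              refine (norm_coeff_Y hu.2).trans ?_
              rw [Real.rpow_neg_one, ← one_div, le_div_iff₀ hu.1]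
              linarith [hu.2]
          rw [norm_mul]
          refine (mul_le_mul hcoeff (hC u hu) (norm_nonneg _)
            (Real.rpow_nonneg hu.1.le _)).trans_eq ?_
          rw [mul_left_comm, ← Real.rpow_add hu.1]
          norm_num
        · have haY : a = .Y := by
            rcases List.mem_cons.mp ha with h | h
            · exact h.symm
            · exact absurd h hw
          subst haY
          obtain ⟨C, hC⟩ := exists_log_pow_le w.length
          refine ⟨2 * C, fun u hu => ?_⟩
          rw [norm_mul, ell_of_notMem hw, mul_assoc]
          exact mul_le_mul (norm_coeff_Y hu.2) (hC u hu) (norm_nonneg _) zero_le_two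
      obtain ⟨h1, h2⟩ := primitive_of_bound hc hC
      rw [ell_of_mem ha]
      exact ⟨h1, fun _ => ⟨2 * C, h2⟩⟩
    · refine ⟨fun s hs => ?_, fun h => absurd h ha⟩
      have hw : Form.Y ∉ w := fun h => ha (List.mem_cons_of_mem _ h)
      have haX : a = .X := by
        cases a with
        | X => rfl
        | Y => exact absurd List.mem_cons_self ha
      subst haX
      have h1 : ell (.X :: w) = fun s =>
          ((Real.log s : ℝ) : ℂ) ^ (w.length + 1) / ((w.length + 1).factorial : ℂ) :=
        funext fun s => ell_of_notMem ha s
      rw [h1, ell_of_notMem hw]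
      refine (hasDerivAt_pow_div_factorial
        (Real.hasDerivAt_log hs.1.ne').ofReal_comp w.length).congr_deriv ?_
      rw [Form.coeff]
      push_cast
      ring
  have key : ContinuousOn (ell w) (Ioo 0 1) ∧
      (Form.Y ∈ w → ∃ C : ℝ, ∀ s ∈ Ioc (0 : ℝ) (1 / 2), ‖ell w s‖ ≤ C * s ^ (1 / 2 : ℝ)) := by
    induction w with
    | nil => exact ⟨continuousOn_const, fun h => absurd h List.not_mem_nil⟩
    | cons a w ih =>
      obtain ⟨h1, h2⟩ := step w ih.1 ih.2 a
      exact ⟨fun s hs => (h1 s hs).continuousAt.continuousWithinAt, h2⟩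
  exact ⟨key.1, key.2, fun a => (step w key.1 key.2 a).1⟩

theorem hasDerivAt_ell (a : Form) (w : List Form) {s : ℝ} (hs : s ∈ Ioo (0 : ℝ) 1) :
    HasDerivAt (ell (a :: w)) (a.coeff s * ell w s) s := (ell_spec w).2.2 a s hs

theorem isFlat_ell {a b : ℝ} (ha : 0 < a) (hb : b < 1) :
    IsFlat (fun x t => x.coeff t) ∅ a b ell :=
  ⟨fun _ _ => rfl, fun w => (ell_spec w).1.mono fun _ ht => ⟨ha.trans_le ht.1, ht.2.trans_lt hb⟩,
    fun x w _ ht => hasDerivAt_ell x w ⟨ha.trans ht.1.1, ht.1.2.trans hb⟩⟩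

theorem isFlat_ell_reflect {a b : ℝ} (ha : 0 < a) (hb : b < 1) :
    IsFlat (fun x t => -x.coeff (1 - t)) ∅ a b fun w t => ell w (1 - t) := by
  have hmem : ∀ t ∈ Icc a b, 1 - t ∈ Ioo (0 : ℝ) 1 := fun t ht =>
    ⟨by linarith [ht.2], by linarith [ht.1]⟩
  refine ⟨fun _ _ => rfl, fun w => (ell_spec w).1.comp (by fun_prop) hmem, fun x w t ht => ?_⟩
  have h := (hasDerivAt_ell x w (hmem t (Ioo_subset_Icc_self ht.1))).comp_const_sub 1 t
  refine h.congr_deriv ?_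
  push_cast
  ring

theorem hasLogExp_ell_of_mem {w : List Form} (h : Form.Y ∈ w) : HasLogExp (ell w) 0 := by
  obtain ⟨C, hC⟩ := (ell_spec w).2.1 h
  refine HasLogExp.of_isBigO (c := 1 / 2) (by norm_num) (IsBigO.of_bound C ?_)
  filter_upwards [Ioo_mem_nhdsGT (show (0 : ℝ) < 1 / 2 by norm_num)] with s hs
  rw [Real.norm_of_nonneg (Real.rpow_nonneg hs.1.le _)]
  exact hC s ⟨hs.1, hs.2.le⟩

theorem exists_hasLogExp_ell (w : List Form) : ∃ P, HasLogExp (ell w) P := by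
  by_cases h : Form.Y ∈ w
  · exact ⟨0, hasLogExp_ell_of_mem h⟩
  · refine ⟨Polynomial.C (w.length.factorial : ℂ)⁻¹ * Polynomial.X ^ w.length,
      (HasLogExp.eval _).congr' (Eventually.of_forall fun s => ?_)⟩
    rw [ell_of_notMem h]
    simp [div_eq_inv_mul]

theorem eq_zero_of_hasDerivAt_zero {g : ℝ → ℂ} (hd : ∀ s ∈ Ioo (0 : ℝ) 1, HasDerivAt g 0 s)
    (h0 : Tendsto g (𝓝[>] 0) (𝓝 0)) {s : ℝ} (hs : s ∈ Ioo (0 : ℝ) 1) : g s = 0 := by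
  refine tendsto_nhds_unique (tendsto_const_nhds.congr' ?_) h0
  filter_upwards [Ioo_mem_nhdsGT hs.1] with r hr
  have hsub : ∀ t ∈ Icc r s, t ∈ Ioo (0 : ℝ) 1 := fun t ht =>
    ⟨hr.1.trans_le ht.1, ht.2.trans_lt hs.2⟩
  exact eq_left_of_hasDerivAt_zero countable_empty
    (fun t ht => (hd t (hsub t ht)).continuousAt.continuousWithinAt)
    (fun t ht => hd t (hsub t (Ioo_subset_Icc_self ht.1))) (right_mem_Icc.mpr hr.2.le)

theorem tendsto_ell {w : List Form} (h : Form.Y ∈ w) : Tendsto (ell w) (𝓝[>] 0) (𝓝 0) := by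
  obtain ⟨c, hc, h1⟩ := hasLogExp_ell_of_mem h
  simp only [Polynomial.eval_zero, sub_zero] at h1
  refine h1.trans_tendsto ?_
  have := (Real.continuousAt_rpow_const 0 c (Or.inr hc.le)).tendsto
  rw [Real.zero_rpow hc.ne'] at this
  exact this.mono_left nhdsWithin_le_nhds

theorem ell_replicate_Y (n : ℕ) {s : ℝ} (hs : s ∈ Ioo (0 : ℝ) 1) :
    ell (List.replicate n .Y) s = ell [.Y] s ^ n / (n.factorial : ℂ) := by
  induction n generalizing s with
  | zero => simp [ell]
  | succ n ih =>
    refine sub_eq_zero.mp (eq_zero_of_hasDerivAt_zero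
      (g := fun s => ell (List.replicate (n + 1) .Y) s -
        ell [.Y] s ^ (n + 1) / ((n + 1).factorial : ℂ)) (fun t ht => ?_) ?_ hs)
    · refine ((hasDerivAt_ell .Y _ ht).sub
        (hasDerivAt_pow_div_factorial (hasDerivAt_ell .Y [] ht) n)).congr_deriv ?_
      rw [ih ht, ell]
      ring
    · have h1 := tendsto_ell (w := List.replicate (n + 1) .Y) (by simp [List.replicate_succ])
      have h2 := ((tendsto_ell (w := [.Y]) (by simp)).pow (n + 1)).div_const
        ((n + 1).factorial : ℂ)
      simpa using h1.sub h2

theorem ell_Y {s : ℝ} (hs : s ∈ Ioo (0 : ℝ) 1) : ell [.Y] s = -((Real.log (1 - s) : ℝ) : ℂ) := by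
  refine eq_neg_of_add_eq_zero_left (eq_zero_of_hasDerivAt_zero
    (g := fun s => ell [.Y] s + ((Real.log (1 - s) : ℝ) : ℂ)) (fun t ht => ?_) ?_ hs)
  · have h1 := ((Real.hasDerivAt_log (sub_pos.mpr ht.2).ne').comp_const_sub 1 t).ofReal_comp
    refine ((hasDerivAt_ell .Y [] ht).add h1).congr_deriv ?_
    rw [Form.coeff, ell]
    push_cast
    ring
  · have h2 : ContinuousAt (fun s : ℝ => ((Real.log (1 - s) : ℝ) : ℂ)) 0 :=
      Complex.continuous_ofReal.continuousAt.comp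
        (ContinuousAt.log (by fun_prop) (by norm_num))
    have h3 := (tendsto_ell (w := [.Y]) (by simp)).add (h2.tendsto.mono_left nhdsWithin_le_nhds)
    simpa using h3

theorem dualPair_ell {s : ℝ} (hs : s ∈ Ioo (0 : ℝ) 1) :
    DualPair (fun w => ell w s) fun w => ell w (1 - s) := by
  have hs' : 1 - s ∈ Ioo (0 : ℝ) 1 := ⟨by linarith [hs.2], by linarith [hs.1]⟩
  refine ⟨fun n => ell_replicate_Y n hs, fun n => ell_replicate_Y n hs', ?_, ?_⟩
  · rw [ell_X, ell_Y hs, neg_neg]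
  · rw [ell_X, ell_Y hs', sub_sub_cancel]

theorem dualitySum_ell (M N : ℕ) {s t : ℝ} (hs : s ∈ Ioo (0 : ℝ) 1) (ht : t ∈ Ioo (0 : ℝ) 1) :
    dualitySum (fun w => ell w t) (fun w => ell w (1 - t)) M (N + 1) =
      dualitySum (fun w => ell w s) (fun w => ell w (1 - s)) M (N + 1) := by
  have aux : ∀ s t : ℝ, s ∈ Ioo (0 : ℝ) 1 → t ∈ Ioo (0 : ℝ) 1 → s ≤ t →
      dualitySum (fun w => ell w t) (fun w => ell w (1 - t)) M (N + 1) =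
      dualitySum (fun w => ell w s) (fun w => ell w (1 - s)) M (N + 1) := by
    intro s t hs ht hst
    exact (isFlat_ell hs.1 ht.2).dualitySum_eq (isFlat_ell_reflect hs.1 ht.2) countable_empty
      (fun u _ => by simp [Form.coeff]) (fun u _ => by simp [Form.coeff]) (dualPair_ell hs) M N
      (right_mem_Icc.mpr hst)
  rcases le_total s t with h | h
  · exact aux s t hs ht h
  · exact (aux t s ht hs h).symm

theorem conv_unitIncl_ell (s t : Ioo (0 : ℝ) 1) (w : List Form) :
    conv (classIntegral ((Path.Homotopic.Quotient.mk (seg s t)).map unitIncl))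
      (fun w => ell w s) w = ell w t :=
  conv_classIntegral_seg unitIncl (G := fun τ => (τ : ℂ)) (G' := fun _ => 1) (fun _ => rfl)
    (fun τ _ => by simpa using (hasDerivAt_id τ).ofReal_comp) continuousOn_const
    (fun _ _ => rfl) (fun x w τ hτ => by simpa using hasDerivAt_ell x w hτ) s t w

/-! ### The arcs of base points -/

/-- The derivative of the arc of a base point. -/
noncomputable def BasePoint.arcDeriv : BasePoint → ℝ → ℂ
  | point _, _ => 0
  | atZero v, _ => v
  | atOne v, _ => v
  | atInfty v, ε => -1 / ((ε : ℂ) ^ 2 * v)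

namespace BasePoint

theorem ne_zero_of_mem {b : BasePoint} {τ : ℝ} (hτ : τ ∈ Ioo 0 b.radius) : (τ : ℂ) ≠ 0 := by
  exact_mod_cast hτ.1.ne'

theorem hasDerivAt_arcFun (b : BasePoint) {τ : ℝ} (hτ : τ ∈ Ioo 0 b.radius) :
    HasDerivAt b.arcFun (b.arcDeriv τ) τ := by
  have h0 := ne_zero_of_mem hτ
  have hid : HasDerivAt (fun τ : ℝ => (τ : ℂ)) 1 τ := by
    simpa using (hasDerivAt_id τ).ofReal_comp
  cases b with
  | point z => exact hasDerivAt_const _ _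
  | atZero v => exact (hid.mul_const (v : ℂ)).congr_deriv (one_mul _)
  | atOne v => exact ((hid.mul_const (v : ℂ)).const_add 1).congr_deriv (one_mul _)
  | atInfty v =>
    have hv : (v : ℂ) ≠ 0 := v.ne_zero
    have h1 := ((hid.mul_const (v : ℂ)).inv (mul_ne_zero h0 hv)).const_add (1 / 2)
    refine (h1.congr_of_eventuallyEq (Eventually.of_forall fun u => ?_)).congr_deriv ?_
    · simp [arcFun]
    · simp only [arcDeriv]
      field_simp

theorem continuousOn_arcDeriv (b : BasePoint) : ContinuousOn b.arcDeriv (Ioo 0 b.radius) := by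
  cases b with
  | point z => exact continuousOn_const
  | atZero v => exact continuousOn_const
  | atOne v => exact continuousOn_const
  | atInfty v =>
    refine continuousOn_const.div (by fun_prop) fun τ hτ => ?_
    exact mul_ne_zero (pow_ne_zero _ (ne_zero_of_mem hτ)) v.ne_zero

/-- The coefficients of the pull-backs of the forms along the arc of a base point. -/
noncomputable def arcCoeff (b : BasePoint) (x : Form) (τ : ℝ) : ℂ :=
  x.coeff (b.arcFun τ) * b.arcDeriv τ

theorem continuousOn_arcCoeff (b : BasePoint) (x : Form) :
    ContinuousOn (b.arcCoeff x) (Ioo 0 b.radius) := by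
  refine ContinuousOn.mul (fun τ hτ => ?_) b.continuousOn_arcDeriv
  exact ((x.continuousAt_coeff (b.arcFun_mem ⟨τ, hτ⟩)).comp
    (b.hasDerivAt_arcFun hτ).continuousAt).continuousWithinAt

theorem isBigO_of_eqOn {ρ : ℝ} (hρ : 0 < ρ) {k h : ℝ → ℂ} (hh : ContinuousAt h 0)
    (heq : ∀ τ ∈ Ioo 0 ρ, k τ = h τ) : k =O[𝓝[>] (0 : ℝ)] fun _ : ℝ => (1 : ℝ) := by
  refine ((hh.tendsto.mono_left nhdsWithin_le_nhds).isBigO_one ℝ).congr' ?_ EventuallyEq.rfl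
  filter_upwards [Ioo_mem_nhdsGT hρ] with τ hτ using (heq τ hτ).symm

/-- The pull-backs of the forms along the arc of a base point have at most a simple pole. -/
theorem exists_residue (b : BasePoint) (x : Form) :
    ∃ r : ℂ, (fun τ : ℝ => b.arcCoeff x τ - r / τ) =O[𝓝[>] (0 : ℝ)] fun _ : ℝ => (1 : ℝ) := by
  -- After removal of the pole each coefficient is either zero or of the form `v / (1 + τ w)`.
  have hcont : ∀ v w : ℂ, ContinuousAt (fun τ : ℝ => v / (1 + (τ : ℂ) * w)) 0 := fun v w =>
    continuousAt_const.div (by fun_prop) (by simp)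
  have hne : ∀ τ : ℝ, τ ∈ Ioo 0 b.radius → (τ : ℂ) ≠ 0 := fun τ hτ => ne_zero_of_mem hτ
  have hmem := fun (τ : ℝ) (hτ : τ ∈ Ioo 0 b.radius) => b.arcFun_mem ⟨τ, hτ⟩
  have hρ := b.radius_pos
  cases b with
  | point z =>
    exact ⟨0, isBigO_of_eqOn hρ (h := fun _ => 0) continuousAt_const fun τ _ => by
      simp [arcCoeff, arcDeriv]⟩
  | atZero v =>
    have hv : (v : ℂ) ≠ 0 := v.ne_zero
    cases x with
    | X =>
      refine ⟨1, isBigO_of_eqOn hρ (h := fun _ => 0) continuousAt_const fun τ hτ => ?_⟩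
      have h0 := hne τ hτ
      simp only [arcCoeff, arcDeriv, arcFun, Form.coeff]
      field_simp
      ring
    | Y =>
      refine ⟨0, isBigO_of_eqOn hρ (hcont v (-v)) fun τ hτ => ?_⟩
      simp only [arcCoeff, arcDeriv, arcFun, Form.coeff]
      ring
  | atOne v =>
    have hv : (v : ℂ) ≠ 0 := v.ne_zero
    cases x with
    | X =>
      refine ⟨0, isBigO_of_eqOn hρ (hcont v v) fun τ hτ => ?_⟩
      simp only [arcCoeff, arcDeriv, arcFun, Form.coeff]
      ring
    | Y =>
      refine ⟨-1, isBigO_of_eqOn hρ (h := fun _ => 0) continuousAt_const fun τ hτ => ?_⟩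
      have h0 := hne τ hτ
      simp only [arcCoeff, arcDeriv, arcFun, Form.coeff]
      rw [show (1 : ℂ) - (1 + τ * v) = -(τ * v) by ring]
      field_simp
      ring
  | atInfty v =>
    have hv : (v : ℂ) ≠ 0 := v.ne_zero
    cases x with
    | X =>
      -- The logarithmic derivative of `(1 + τ v / 2) / (τ v)` is `-1 / τ + (v / 2) / (1 + τ v /
      -- 2)`.
      refine ⟨-1, isBigO_of_eqOn hρ (hcont (v / 2) (v / 2)) fun τ hτ => ?_⟩
      have h0 := hne τ hτ
      have h1 := (hmem τ hτ).1
      simp only [arcFun] at h1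
      have e : (1 : ℂ) / 2 + 1 / (τ * v) = (1 + τ * (v / 2)) / (τ * v) := by
        field_simp
        ring
      rw [e] at h1
      have h2 : 1 + (τ : ℂ) * (v / 2) ≠ 0 := fun h => h1 (by rw [h, zero_div])
      simp only [arcCoeff, arcDeriv, arcFun, Form.coeff]
      rw [e, one_div_div, div_mul_div_comm, div_sub_div _ _ (by positivity) h0, div_eq_div_iff]
      · ring
      · positivity
      · exact h2
    | Y =>
      refine ⟨1, isBigO_of_eqOn hρ (hcont (v / 2) (-(v / 2))) fun τ hτ => ?_⟩
      have h0 := hne τ hτ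
      have h1 := (hmem τ hτ).2
      simp only [arcFun] at h1
      have e : (1 : ℂ) - (1 / 2 + 1 / (τ * v)) = -(1 + τ * (-(v / 2))) / (τ * v) := by
        field_simp
        ring
      have h2 : 1 + (τ : ℂ) * (-(v / 2)) ≠ 0 := fun h => h1 (by
        rw [h, neg_zero, zero_div] at e
        exact (sub_eq_zero.mp e).symm)
      simp only [arcCoeff, arcDeriv, arcFun, Form.coeff]
      have h3 : -(1 + (τ : ℂ) * (-(v / 2))) * ((τ : ℂ) ^ 2 * v) ≠ 0 :=
        mul_ne_zero (neg_ne_zero.mpr h2) (by positivity)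
      rw [e, one_div_div, div_mul_div_comm, div_sub_div _ _ h3 h0,
        div_eq_div_iff (mul_ne_zero h3 h0) h2]
      ring

end BasePoint

theorem exists_primitive_Ioo {h : ℝ → ℂ} {ρ : ℝ} (hh : ContinuousOn h (Ioo 0 ρ)) {t₀ : ℝ}
    (ht₀ : t₀ ∈ Ioo 0 ρ) :
    ∃ F : ℝ → ℂ, F t₀ = 0 ∧ ∀ τ ∈ Ioo 0 ρ, HasDerivAt F (h τ) τ := by
  refine ⟨fun τ => ∫ u in t₀..τ, h u, by simp, fun τ hτ => ?_⟩
  exact intervalIntegral.integral_hasDerivAt_right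
    (hh.mono (ordConnected_Ioo.uIcc_subset ht₀ hτ)).intervalIntegrable
    (hh.stronglyMeasurableAtFilter isOpen_Ioo τ hτ) (hh.continuousAt (isOpen_Ioo.mem_nhds hτ))

theorem exists_flat_family {k : Form → ℝ → ℂ} {ρ : ℝ} (hk : ∀ x, ContinuousOn (k x) (Ioo 0 ρ))
    {t₀ : ℝ} (ht₀ : t₀ ∈ Ioo 0 ρ) :
    ∃ E : List Form → ℝ → ℂ, (∀ τ, E [] τ = 1) ∧ (∀ w, E w t₀ = unitSeries w) ∧
      ∀ x w, ∀ τ ∈ Ioo 0 ρ, HasDerivAt (E (x :: w)) (k x τ * E w τ) τ := by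
  have hex : ∀ (x : Form) (g : {g : ℝ → ℂ // ContinuousOn g (Ioo 0 ρ)}),
      ∃ h : {g : ℝ → ℂ // ContinuousOn g (Ioo 0 ρ)}, h.1 t₀ = 0 ∧
        ∀ τ ∈ Ioo 0 ρ, HasDerivAt h.1 (k x τ * g.1 τ) τ := by
    intro x g
    obtain ⟨F, h0, hF⟩ := exists_primitive_Ioo ((hk x).mul g.2) ht₀
    exact ⟨⟨F, fun τ hτ => (hF τ hτ).continuousAt.continuousWithinAt⟩, h0, hF⟩
  choose step hval hder using hex
  let E : List Form → {g : ℝ → ℂ // ContinuousOn g (Ioo 0 ρ)} := fun w =>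
    List.rec ⟨fun _ => 1, continuousOn_const⟩ (fun x _ g => step x g) w
  refine ⟨fun w => (E w).1, fun _ => rfl, fun w => ?_, fun x w τ hτ => hder x (E w) τ hτ⟩
  cases w with
  | nil => rfl
  | cons x w => exact hval x (E w)

/-- The iterated integrals along the arc of a base point have logarithmic expansions. -/
theorem BasePoint.exists_move_expansion (b : BasePoint) :
    ∃ E : List Form → ℝ → ℂ, (∀ w (t : b.Param), classIntegral (b.move b.mid t) w = E w t) ∧
      ∀ w, ∃ P, HasLogExp (E w) P := by
  obtain ⟨E, hnil, h0, hE⟩ := exists_flat_family b.continuousOn_arcCoeff b.mid.2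
  refine ⟨E, fun w t => ?_, fun w => ?_⟩
  · have h1 := conv_classIntegral_seg b.arc (G := b.arcFun) (G' := b.arcDeriv) (fun _ => rfl)
      (fun τ hτ => b.hasDerivAt_arcFun hτ) b.continuousOn_arcDeriv (fun τ _ => hnil τ) hE b.mid t w
    -- `E` is the unit series at the midpoint, so the transport formula identifies it with the
    -- integrals themselves.
    rw [funext h0, conv_unit] at h1
    exact h1
  · induction w with
    | nil => exact ⟨_, (HasLogExp.const 1).congr' (Eventually.of_forall fun τ => (hnil τ).symm)⟩
    | cons x w ih =>
      obtain ⟨P, hP⟩ := ih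
      obtain ⟨r, hr⟩ := b.exists_residue x
      exact hP.primitive b.radius_pos hr (hE x w)

/-! ### Logarithmic expansions of products of series -/

section

variable {c d : List Form → ℝ → ℂ}

theorem exists_hasLogExp_conv (hc : ∀ w, ∃ P, HasLogExp (c w) P)
    (hd : ∀ w, ∃ P, HasLogExp (d w) P) (w : List Form) :
    ∃ P, HasLogExp (fun ε => conv (fun v => c v ε) (fun v => d v ε) w) P := by
  induction w generalizing c with
  | nil =>
    obtain ⟨P, hP⟩ := hc []
    obtain ⟨Q, hQ⟩ := hd []
    exact ⟨_, hP.mul hQ⟩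
  | cons x w ih =>
    obtain ⟨P, hP⟩ := hc []
    obtain ⟨Q, hQ⟩ := hd (x :: w)
    obtain ⟨R, hR⟩ := ih fun v => hc (x :: v)
    exact ⟨_, (hP.mul hQ).add hR⟩

/-- A series with constant coefficient `1` can be divided out recursively. This yields expansions of
the doubly cut integrals, where both ends move with `ε`, from those of `polylog` and `ell`. -/
theorem exists_hasLogExp_of_conv (hd : ∀ w, ∃ P, HasLogExp (d w) P) (hnil : ∀ ε, d [] ε = 1)
    (h : ∀ w, ∃ P, HasLogExp (fun ε => conv (fun v => c v ε) (fun v => d v ε) w) P)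
    (w : List Form) : ∃ P, HasLogExp (c w) P := by
  have h0 : ∃ P, HasLogExp (c []) P := by
    obtain ⟨P, hP⟩ := h []
    exact ⟨P, hP.congr' (Eventually.of_forall fun ε => by simp [conv, hnil])⟩
  induction w generalizing c with
  | nil => exact h0
  | cons x w ih =>
    have h1 : ∀ v, ∃ P, HasLogExp
        (fun ε => conv (fun v => c (x :: v) ε) (fun v => d v ε) v) P := fun v => by
      obtain ⟨P, hP⟩ := h0
      obtain ⟨Q, hQ⟩ := hd (x :: v)
      obtain ⟨R, hR⟩ := h (x :: v)
      exact ⟨_, (hR.sub (hP.mul hQ)).congr' (Eventually.of_forall fun ε => by simp [conv])⟩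
    refine ih (c := fun v => c (x :: v)) h1 ?_
    obtain ⟨P, hP⟩ := h1 []
    exact ⟨P, hP.congr' (Eventually.of_forall fun ε => by simp [conv, hnil])⟩

/-- In the product at a word ending in `Y`, every term but the one with empty right factor has a
right factor containing that `Y`. It is a positive power of `ε`, which beats the logarithmic growth
of the left factor. -/
theorem hasLogExp_conv_sub (hc : ∀ w, ∃ P, HasLogExp (c w) P)
    (hd : ∀ w, Form.Y ∈ w → HasLogExp (d w) 0) (hnil : ∀ ε, d [] ε = 1) (w : List Form) :
    HasLogExp (fun ε => conv (fun v => c v ε) (fun v => d v ε) (w ++ [.Y]) - c (w ++ [.Y]) ε)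
      0 := by
  have h1 : ∀ {v : List Form}, Form.Y ∈ v → HasLogExp (fun ε => c [] ε * d v ε) 0 := fun hv => by
    obtain ⟨P, hP⟩ := hc []
    simpa using hP.mul (hd _ hv)
  induction w generalizing c with
  | nil =>
    refine (h1 (v := [.Y]) (by simp)).congr' (Eventually.of_forall fun ε => ?_)
    simp [conv, hnil]
  | cons x w ih =>
    have h2 := ih (c := fun v => c (x :: v)) (fun v => hc (x :: v)) fun {v} hv => by
      obtain ⟨P, hP⟩ := hc [x]
      simpa using hP.mul (hd _ hv)
    have h3 := (h1 (v := x :: (w ++ [.Y])) (by simp)).add h2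
    rw [zero_add] at h3
    refine h3.congr' (Eventually.of_forall fun ε => ?_)
    simp only [List.cons_append, conv]
    ring

end

/-! ### Regularised integrals along classes -/

open Classical in
/-- The iterated integrals along the class obtained from `γ` by cutting it off at `ε`. -/
noncomputable def cutIntegral {b b' : BasePoint} (γ : PathClass b b') (w : List Form) (ε : ℝ) : ℂ :=
  if h : ε ∈ Ioo 0 b.radius ∧ ε ∈ Ioo 0 b'.radius then
    classIntegral (γ.cls ⟨ε, h.1⟩ ⟨ε, h.2⟩) w else 0

theorem cutIntegral_eq {b b' : BasePoint} (γ : PathClass b b') (w : List Form) {ε : ℝ}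
    (hs : ε ∈ Ioo 0 b.radius) (ht : ε ∈ Ioo 0 b'.radius) :
    cutIntegral γ w ε = classIntegral (γ.cls ⟨ε, hs⟩ ⟨ε, ht⟩) w := dif_pos ⟨hs, ht⟩

theorem eventually_mem_radius (b : BasePoint) : ∀ᶠ ε in 𝓝[>] (0 : ℝ), ε ∈ Ioo 0 b.radius :=
  Ioo_mem_nhdsGT b.radius_pos

theorem hasIntegral_of_hasRegValue {b b' : BasePoint} {γ : PathClass b b'} {w : List Form} {L : ℂ}
    (h : HasRegValue (cutIntegral γ w) L) : HasIntegral γ w L := by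
  refine ⟨cutIntegral γ w, fun ε hs ht => ?_, h⟩
  rw [cutIntegral_eq γ w hs ht]
  exact isIterIntegral_classIntegral _ _

theorem HasIntegral.unique {b b' : BasePoint} {γ : PathClass b b'} {w : List Form} {L L' : ℂ}
    (h : HasIntegral γ w L) (h' : HasIntegral γ w L') : L = L' := by
  obtain ⟨f, hf, hL⟩ := h
  obtain ⟨g, hg, hL'⟩ := h'
  refine hL.unique hL' ?_
  filter_upwards [eventually_mem_radius b, eventually_mem_radius b'] with ε hs ht
  rw [(hf ε hs ht).eq_classIntegral, (hg ε hs ht).eq_classIntegral]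

theorem HasIntegral.integral_eq {b b' : BasePoint} {γ : PathClass b b'} {w : List Form} {L : ℂ}
    (h : HasIntegral γ w L) : integral γ w = L := by
  have hex : ∃ L, HasIntegral γ w L := ⟨L, h⟩
  rw [integral, dif_pos hex]
  exact hex.choose_spec.unique h

/-! ### Polylogarithms along classes that start at the tangential base point -/

namespace PathClass

theorem cls_eq_move_trans {b b' : BasePoint} (γ : PathClass b b') (s s' : b.Param) (t : b'.Param) :
    γ.cls s t = (b.move s s').trans (γ.cls s' t) := by
  rw [γ.compat s s' t t, b'.move_self, Path.Homotopic.Quotient.trans_refl]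

theorem cls_eq_trans_move {b b' : BasePoint} (γ : PathClass b b') (s : b.Param) (t t' : b'.Param) :
    γ.cls s t = (γ.cls s t').trans (b'.move t' t) := by
  rw [γ.compat s s t t', b.move_self, Path.Homotopic.Quotient.refl_trans]

end PathClass

variable {b : BasePoint}

/-- The multiple polylogarithms at the points of the arc of the end point of a class. -/
noncomputable def polylog (γ : PathClass b01 b) (t : b.Param) : List Form → ℂ :=
  conv (classIntegral (γ.cls b01.mid t)) fun w => ell w b01.mid.1

theorem conv_move_b01_ell (s s' : b01.Param) :
    conv (classIntegral (b01.move s s')) (fun w => ell w s) = fun w => ell w s' := by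
  rw [move_b01, classIntegral_cast]
  exact funext (conv_unitIncl_ell ⟨s.1, b01_param s⟩ ⟨s'.1, b01_param s'⟩)

theorem conv_delta_ell (s : b01.Param) (t : b10.Param) :
    conv (classIntegral (delta.cls s t)) (fun w => ell w s) = fun w => ell w (1 - t) := by
  have h : classIntegral (delta.cls s t) = classIntegral ((Path.Homotopic.Quotient.mk
      (seg (⟨s.1, b01_param s⟩ : Ioo (0 : ℝ) 1) ⟨1 - t.1, b10_param t⟩)).map unitIncl) :=
    classIntegral_cast ((Path.Homotopic.Quotient.mk
      (seg (⟨s.1, b01_param s⟩ : Ioo (0 : ℝ) 1) ⟨1 - t.1, b10_param t⟩)).map unitIncl)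
        (arc_b01 s) (arc_b10 t)
  rw [h]
  exact funext (conv_unitIncl_ell ⟨s.1, b01_param s⟩ ⟨1 - t.1, b10_param t⟩)

theorem classIntegral_trans' {x y z : U} (c : Path.Homotopic.Quotient x y)
    (d : Path.Homotopic.Quotient y z) :
    classIntegral (c.trans d) = conv (classIntegral d) (classIntegral c) :=
  funext (classIntegral_trans c d)

/-- Moving the start along the arc at `0` transports `ell` to `ell`, so the cut point is irrelevant
and the regularised start needs no limit. -/
theorem polylog_eq (γ : PathClass b01 b) (s : b01.Param) (t : b.Param) :
    polylog γ t = conv (classIntegral (γ.cls s t)) fun w => ell w s := by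
  rw [polylog, γ.cls_eq_move_trans b01.mid s, classIntegral_trans', funext (conv_assoc _ _ _),
    conv_move_b01_ell]

theorem polylog_delta (t : b10.Param) : polylog delta t = fun w => ell w (1 - t) :=
  conv_delta_ell _ _

theorem polylog_X (γ : PathClass b01 b) (s : b01.Param) (t : b.Param) :
    polylog γ t [.X] = ell [.X] s + classIntegral (γ.cls s t) [.X] := by
  rw [polylog_eq γ s]
  simp [conv, classIntegral_nil, ell]

open Classical in
/-- The multiple polylogarithms along the arc of the end point of a class. -/
noncomputable def polylogFun (γ : PathClass b01 b) (w : List Form) (ε : ℝ) : ℂ :=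
  if h : ε ∈ Ioo 0 b.radius then polylog γ ⟨ε, h⟩ w else 0

theorem polylogFun_eq (γ : PathClass b01 b) (w : List Form) {ε : ℝ} (h : ε ∈ Ioo 0 b.radius) :
    polylogFun γ w ε = polylog γ ⟨ε, h⟩ w := dif_pos h

theorem exists_hasLogExp_polylogFun (γ : PathClass b01 b) (w : List Form) :
    ∃ P, HasLogExp (polylogFun γ w) P := by
  obtain ⟨E, hE, hP⟩ := b.exists_move_expansion
  obtain ⟨P, h⟩ := exists_hasLogExp_conv (d := fun v _ => polylog γ b.mid v) hP
    (fun v => ⟨_, HasLogExp.const _⟩) w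
  refine ⟨P, h.congr' ?_⟩
  filter_upwards [eventually_mem_radius b] with ε hε
  have h1 : polylog γ ⟨ε, hε⟩ w =
      conv (classIntegral (b.move b.mid ⟨ε, hε⟩)) (polylog γ b.mid) w := by
    simp only [polylog]
    rw [γ.cls_eq_trans_move b01.mid ⟨ε, hε⟩ b.mid, classIntegral_trans', conv_assoc]
  rw [polylogFun_eq γ w hε, h1]
  congr 1
  exact funext fun v => (hE v ⟨ε, hε⟩).symm

/-- The starting cut is free, so it may be taken equal to the cut at the end. -/
theorem polylogFun_eq_conv (γ : PathClass b01 b) (w : List Form) :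
    ∀ᶠ ε in 𝓝[>] (0 : ℝ),
      polylogFun γ w ε = conv (fun v => cutIntegral γ v ε) (fun v => ell v ε) w := by
  filter_upwards [eventually_mem_radius b, eventually_mem_radius b01] with ε ht hs
  rw [polylogFun_eq γ w ht, polylog_eq γ ⟨ε, hs⟩]
  congr 1
  exact funext fun v => (cutIntegral_eq γ v hs ht).symm

theorem exists_hasLogExp_cutIntegral (γ : PathClass b01 b) (w : List Form) :
    ∃ P, HasLogExp (cutIntegral γ w) P := by
  refine exists_hasLogExp_of_conv (d := ell) exists_hasLogExp_ell (fun _ => rfl) (fun v => ?_) w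
  obtain ⟨P, hP⟩ := exists_hasLogExp_polylogFun γ v
  exact ⟨P, hP.congr' (polylogFun_eq_conv γ v)⟩

/-- The regularised value of the iterated integral of a word that ends with `Y`. -/
theorem HasLogExp.hasIntegral {γ : PathClass b01 b} {w : List Form} {P : Polynomial ℂ}
    (hP : HasLogExp (polylogFun γ (w ++ [.Y])) P) :
    HasIntegral γ (w ++ [.Y]) (P.coeff 0) := by
  have h := hasLogExp_conv_sub (c := cutIntegral γ) (d := ell) (exists_hasLogExp_cutIntegral γ)
    (fun _ => hasLogExp_ell_of_mem) (fun _ => rfl) w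
  have h1 : HasLogExp (cutIntegral γ (w ++ [.Y])) (P - 0) := (hP.sub h).congr' <| by
    filter_upwards [polylogFun_eq_conv γ (w ++ [.Y])] with ε hε
    rw [hε]
    ring
  rw [sub_zero] at h1
  exact hasIntegral_of_hasRegValue h1.hasRegValue

/-- The regularised value of the logarithm. -/
theorem HasLogExp.hasIntegral_log {γ : PathClass b01 b} {P : Polynomial ℂ}
    (hP : HasLogExp (polylogFun γ [.X]) P) :
    HasIntegral (delta.symm.trans γ) [.X] (P.coeff 0) := by
  refine hasIntegral_of_hasRegValue (HasLogExp.hasRegValue ?_)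
  -- The cut-off of `δ⁻¹` at `1 - ε` contributes `-log (1 - ε)`, which is `ell [.Y]` at `ε` and
  -- tends to `0`.
  have h := hP.add (hasLogExp_ell_of_mem (w := [.Y]) (by simp))
  rw [add_zero] at h
  refine h.congr' ?_
  filter_upwards [eventually_mem_radius b, eventually_mem_radius b10,
    Ioo_mem_nhdsGT one_pos] with ε ht hs h1
  rw [polylogFun_eq γ _ ht, cutIntegral_eq _ _ hs ht, PathClass.trans_cls _ _ _ b01.mid,
    classIntegral_trans_singleton, polylog_X γ b01.mid]
  change _ = classIntegral ((delta.cls b01.mid ⟨ε, hs⟩).symm) _ + _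
  rw [classIntegral_symm_singleton]
  have h2 := polylog_X delta b01.mid ⟨ε, hs⟩
  rw [polylog_delta] at h2
  simp only [ell_X] at h2 ⊢
  rw [ell_Y h1]
  linear_combination -h2

/-! ### The dual path -/

/-- The class `δ · φ(γ)` is split on the arc at `1` at the point `1 - u`, the image of the point `u`
where `γ` starts; `δ` carries `ell` to that point. -/
theorem polylog_dualPath (γ : PathClass b01 b) (u : b01.Param) (t : b.reflect.Param) :
    polylog (dualPath γ) t =
      conv (classIntegral ((γ.cls u (b.unreflect t)).map phi)) fun w => ell w (1 - u) := by
  have hu : u.1 ∈ Ioo 0 b10.radius := by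
    rw [← b01_reflect, BasePoint.radius_reflect]
    exact u.2
  -- `γ.reflect` starts at `b01.reflect`, which is `b10` only by unfolding; naming it `d` fixes its
  -- type before rewriting.
  obtain ⟨d, hd, h⟩ : ∃ d : PathClass b10 b.reflect, dualPath γ = delta.trans d ∧
      classIntegral (d.cls ⟨u.1, hu⟩ t) = classIntegral ((γ.cls u (b.unreflect t)).map phi) :=
    ⟨γ.reflect, rfl, classIntegral_cast _ _ _⟩
  rw [polylog, hd, PathClass.trans_cls _ _ _ ⟨u.1, hu⟩, classIntegral_trans',
    funext (conv_assoc _ _ _), conv_delta_ell, h]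

theorem dualPair_polylog (γ : PathClass b01 b) (t : b.reflect.Param) (u : b01.Param) :
    DualPair (polylog γ (b.unreflect t)) (polylog (dualPath γ) t) ∧
    ∀ M N, dualitySum (polylog γ (b.unreflect t)) (polylog (dualPath γ) t) M (N + 1) =
      dualitySum (fun w => ell w u) (fun w => ell w (1 - u)) M (N + 1) := by
  rw [polylog_eq γ u, polylog_dualPath γ u]
  exact DualPair.transport _ rfl rfl (dualPair_ell (b01_param u))

/-! ### Regularisation of the duality sum -/

/-- The sum is a polynomial in the values of the series, and taking the constant term is a ring
homomorphism. -/
theorem exists_hasLogExp_logSum {c : List Form → ℝ → ℂ} {P : List Form → Polynomial ℂ}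
    (h : ∀ w, HasLogExp (c w) (P w)) (M : ℕ) (v : List Form) :
    ∃ Q, HasLogExp (fun ε => logSum (fun w => c w ε) M v) Q ∧
      Q.coeff 0 = logSum (fun w => (P w).coeff 0) M v := by
  refine ⟨_, HasLogExp.sum (P := fun j => Polynomial.C (j.factorial : ℂ)⁻¹ * (-P [.X]) ^ j *
    P (List.replicate (M - j) .X ++ v)) _ fun j _ => ?_, ?_⟩
  · refine ((((h [.X]).neg.pow j).const_mul _).mul (h _)).congr' (Eventually.of_forall fun ε => ?_)
    rw [div_eq_inv_mul]
  · simp only [logSum, Polynomial.coeff_zero_eq_eval_zero, Polynomial.eval_finsetSum,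
      Polynomial.eval_mul, Polynomial.eval_C, Polynomial.eval_pow, Polynomial.eval_neg,
      div_eq_inv_mul]

theorem exists_hasLogExp_dualitySum {c d : List Form → ℝ → ℂ} {P Q : List Form → Polynomial ℂ}
    (hc : ∀ w, HasLogExp (c w) (P w)) (hd : ∀ w, HasLogExp (d w) (Q w)) (M N : ℕ) :
    ∃ R, HasLogExp (fun ε => dualitySum (fun w => c w ε) (fun w => d w ε) M N) R ∧
      R.coeff 0 = dualitySum (fun w => (P w).coeff 0) (fun w => (Q w).coeff 0) M N := by
  obtain ⟨R₁, h1, e1⟩ := exists_hasLogExp_logSum hc M (List.replicate N .Y)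
  obtain ⟨R₂, h2, e2⟩ := exists_hasLogExp_logSum hd N (List.replicate M .Y)
  have h3 := (((hd [.X]).neg.pow N).const_mul (N.factorial : ℂ)⁻¹).mul (hd (List.replicate M .Y))
  refine ⟨_, (h1.add (h2.sub h3)).congr' (Eventually.of_forall fun ε => ?_), ?_⟩
  · rw [dualitySum, div_eq_inv_mul]
  · rw [Polynomial.coeff_add, Polynomial.coeff_sub, e1, e2, dualitySum]
    simp only [Polynomial.coeff_zero_eq_eval_zero, Polynomial.eval_mul, Polynomial.eval_C,
      Polynomial.eval_pow, Polynomial.eval_neg, div_eq_inv_mul]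

/-- The regularised polylogarithms of the words in `X` and `Y`. -/
noncomputable def regPolylog (γ : PathClass b01 b) (w : List Form) : ℂ :=
  (exists_hasLogExp_polylogFun γ w).choose.coeff 0

theorem hasIntegral_regPolylog (γ : PathClass b01 b) (w : List Form) :
    HasIntegral γ (w ++ [.Y]) (regPolylog γ (w ++ [.Y])) :=
  (exists_hasLogExp_polylogFun γ _).choose_spec.hasIntegral

theorem hasIntegral_regPolylog_X (γ : PathClass b01 b) :
    HasIntegral (delta.symm.trans γ) [.X] (regPolylog γ [.X]) :=
  (exists_hasLogExp_polylogFun γ _).choose_spec.hasIntegral_log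

theorem logAlong_eq (γ : PathClass b01 b) : logAlong γ = regPolylog γ [.X] :=
  (hasIntegral_regPolylog_X γ).integral_eq

theorem word_cons (i : ℕ) (k : List ℕ) :
    word (i :: k) = (word k ++ List.replicate (i - 1) .X) ++ [.Y] := by
  simp [word]

theorem hasIntegral_word (γ : PathClass b01 b) {k : List ℕ} (hk : k ≠ []) :
    HasIntegral γ (word k) (regPolylog γ (word k)) := by
  cases k with
  | nil => exact absurd rfl hk
  | cons i k =>
    rw [word_cons]
    exact hasIntegral_regPolylog γ _

theorem Li_eq (γ : PathClass b01 b) {k : List ℕ} (hk : k ≠ []) :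
    Li k γ = regPolylog γ (word k) :=
  (hasIntegral_word γ hk).integral_eq

/-- Before regularisation the duality sum is already constant in `ε`, so its regularised value is
that constant. -/
theorem dualitySum_regPolylog (γ : PathClass b01 b) (M N : ℕ) :
    dualitySum (regPolylog γ) (regPolylog (dualPath γ)) M (N + 1) =
      dualitySum (fun w => ell w b01.mid) (fun w => ell w (1 - b01.mid.1)) M (N + 1) := by
  obtain ⟨R, hR, e⟩ := exists_hasLogExp_dualitySum
    (fun w => (exists_hasLogExp_polylogFun γ w).choose_spec)
    (fun w => (exists_hasLogExp_polylogFun (dualPath γ) w).choose_spec) M (N + 1)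
  refine e.symm.trans ((hR.coeff_zero_unique (HasLogExp.const _) ?_).trans
    (Polynomial.coeff_C_zero))
  filter_upwards [eventually_mem_radius b, eventually_mem_radius b.reflect] with ε h1 h2
  rw [← (dualPair_polylog γ ⟨ε, h2⟩ b01.mid).2 M N]
  congr 1
  · exact funext fun w => polylogFun_eq γ w h1
  · exact funext fun w => polylogFun_eq _ w h2

/-! ### The constant as a zeta value -/

theorem logSum_of_X_eq_zero {c : List Form → ℂ} (h : c [.X] = 0) (M : ℕ) (v : List Form) :
    logSum c M v = c (List.replicate M .X ++ v) := by
  rw [logSum, Finset.sum_eq_single 0]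
  · simp
  · intro j _ hj
    simp [h, hj]
  · simp

/-- The constant is evaluated at `1 - ε` with dual point `ε`. There `log (1 - ε)` tends to `0`, `log
ε` has regularised value `0`, and every word of the dual sum contains `Y` and vanishes in the limit.
Only the term `j = 0` of the first sum is left. -/
theorem regPolylog_delta (M N : ℕ) :
    dualitySum (fun w => ell w b01.mid) (fun w => ell w (1 - b01.mid.1)) (M + 1) (N + 1) =
      regPolylog delta (List.replicate (M + 1) .X ++ List.replicate (N + 1) .Y) := by
  choose P hP using exists_hasLogExp_ell
  have hPY : ∀ w, Form.Y ∈ w → (P w).coeff 0 = 0 := fun w hw => by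
    rw [(hP w).coeff_zero_unique (hasLogExp_ell_of_mem hw) (Eventually.of_forall fun _ => rfl),
      Polynomial.coeff_zero]
  have hPX : (P [.X]).coeff 0 = 0 := by
    rw [(hP [.X]).coeff_zero_unique (HasLogExp.eval Polynomial.X)
      (Eventually.of_forall fun s => by rw [ell_X, Polynomial.eval_X]), Polynomial.coeff_X_zero]
  have hδX : regPolylog delta [.X] = 0 := by
    refine ((exists_hasLogExp_polylogFun delta [.X]).choose_spec.coeff_zero_unique
      (hasLogExp_ell_of_mem (w := [.Y]) (by simp)).neg ?_).trans (by simp)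
    filter_upwards [eventually_mem_radius b10, Ioo_mem_nhdsGT one_pos] with ε h1 h2
    rw [polylogFun_eq delta _ h1, polylog_delta, ell_Y h2, neg_neg]
    exact ell_X _
  obtain ⟨R, hR, e⟩ := exists_hasLogExp_dualitySum
    (fun w => (exists_hasLogExp_polylogFun delta w).choose_spec) hP (M + 1) (N + 1)
  have h1 : R.coeff 0 = dualitySum (fun w => ell w b01.mid) (fun w => ell w (1 - b01.mid.1))
      (M + 1) (N + 1) := by
    refine (hR.coeff_zero_unique (HasLogExp.const _) ?_).trans (Polynomial.coeff_C_zero)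
    filter_upwards [eventually_mem_radius b10, Ioo_mem_nhdsGT one_pos] with ε h1 h2
    have h3 : 1 - ε ∈ Ioo (0 : ℝ) 1 := ⟨by linarith [h2.2], by linarith [h2.1]⟩
    rw [← dualitySum_ell (M + 1) N (b01_param b01.mid) h3]
    congr 1
    · exact funext fun w => by rw [polylogFun_eq delta w h1, polylog_delta]
    · rw [sub_sub_cancel]
  have e' : R.coeff 0 = dualitySum (regPolylog delta) (fun w => (P w).coeff 0) (M + 1) (N + 1) := e
  rw [← h1, e', dualitySum, logSum_of_X_eq_zero hδX, logSum_of_X_eq_zero hPX,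
    hPY (List.replicate (N + 1) Form.X ++ List.replicate (M + 1) Form.Y) (by simp),
    hPY (List.replicate (M + 1) Form.Y) (by simp)]
  simp

/-! ### Translation to multi-indices -/

theorem word_replicate_append (a i : ℕ) :
    word (List.replicate a 1 ++ [i]) = List.replicate (i - 1) .X ++ List.replicate (a + 1) .Y := by
  have h : ∀ a : ℕ, (List.replicate a 1).flatMap
      (fun i => List.replicate (i - 1) Form.X ++ [Form.Y]) = List.replicate a .Y := by
    intro a
    induction a with
    | zero => rfl
    | succ a ih => rw [List.replicate_succ, List.flatMap_cons, ih]; rfl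
  simp only [word, List.reverse_append, List.reverse_replicate, List.reverse_singleton,
    List.singleton_append, List.flatMap_cons, h, List.append_assoc]
  rfl

/-- The subtracted term is the top term `j = N` of the second sum; this accounts for the asymmetric
ranges in the formula. -/
theorem dualitySum_succ (c d : List Form → ℂ) (M N : ℕ) :
    dualitySum c d M N = (∑ j ∈ Finset.range (M + 1), (-c [.X]) ^ j / (j.factorial : ℂ) *
      c (List.replicate (M - j) .X ++ List.replicate N .Y)) +
    ∑ j ∈ Finset.range N, (-d [.X]) ^ j / (j.factorial : ℂ) *
      d (List.replicate (N - j) .X ++ List.replicate M .Y) := by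
  rw [dualitySum, logSum, logSum, Finset.sum_range_succ _ N]
  simp

end MPL

theorem theorem1p1 (b : MPL.BasePoint) (γ : MPL.PathClass MPL.b01 b) :
    -- the logarithm and all multiple polylogarithms along `γ` are well defined
    MPL.HasIntegral (MPL.delta.symm.trans γ) [MPL.Form.X] (MPL.logAlong γ) ∧
    (∀ k : List ℕ, k ≠ [] → (∀ i ∈ k, 1 ≤ i) →
      MPL.HasIntegral γ (MPL.word k) (MPL.Li k γ)) ∧
    -- the duality-reflection formula
    ∀ n m : ℕ, 2 ≤ n → 2 ≤ m →
      (∑ j ∈ Finset.range m, (-MPL.logAlong γ) ^ j / (j.factorial : ℂ) *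
          MPL.Li (List.replicate (n - 2) 1 ++ [m - j]) γ) +
        (∑ j ∈ Finset.range (n - 1), (-MPL.logAlong (MPL.dualPath γ)) ^ j / (j.factorial : ℂ) *
          MPL.Li (List.replicate (m - 2) 1 ++ [n - j]) (MPL.dualPath γ)) =
      MPL.zeta (List.replicate (n - 2) 1 ++ [m]) := by
  refine ⟨?_, fun k hk _ => ?_, fun n m hn hm => ?_⟩
  · rw [MPL.logAlong_eq]
    exact MPL.hasIntegral_regPolylog_X γ
  · rw [MPL.Li_eq γ hk]
    exact MPL.hasIntegral_word γ hk
  · obtain ⟨N, rfl⟩ := Nat.exists_eq_add_of_le' hn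
    obtain ⟨M, rfl⟩ := Nat.exists_eq_add_of_le' hm
    -- Here `M + 1 = m - 1` counts the letters `X` and `N + 1 = n - 1` the letters `Y` of the word
    -- of the zeta value.
    have key := (MPL.dualitySum_regPolylog γ (M + 1) N).trans (MPL.regPolylog_delta M N)
    rw [MPL.dualitySum_succ] at key
    have hne : ∀ (a i : ℕ), List.replicate a 1 ++ [i] ≠ [] := fun a i => by simp
    rw [MPL.zeta, MPL.Li_eq _ (hne _ _)]
    simp only [MPL.Li_eq _ (hne _ _), MPL.logAlong_eq, MPL.word_replicate_append]
    -- The exponent `(m - j) - 1` produced by `word` becomes `(m - 1) - j`, and likewise for `n`.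
    simp only [Nat.add_sub_cancel, Nat.sub_right_comm _ _ 1]
    exact key
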